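/- Let $\Lambda_q=\mathbb{Q}[q_{i,j},\phi]$, with generators $q_{i,j}$ for $i,j\ge 0$, $i\equiv j \pmod 2$, and let $\widehat{\Lambda_q}=\Lambda_q[q_{0,-2},q_{1,-1}]$. On either ring put $$\partial_1=\sum_{i,j}\binom i2 q_{i-2,j}\,\partial_{q_{i,j}},\qquad \partial_2=\sum_{i,j,k,l}\tfrac12 ik\, q_{i+k-2,j+l}\,\partial_{q_{i,j}}\partial_{q_{k,l}},$$ $$\partial'_\psi=\sum_{i,j}\binom i2\phi\, q_{i-2,j-2}\,\partial_{q_{i,j}},\qquad \partial_\psi=\sum_{i,j,k,l}\tfrac12 ik\,\phi\, q_{i-1,j-1}q_{k-1,l-1}\,\partial_{q_{i,j}}\partial_{q_{k,l}},$$ where the sums run over the indices of the generators of the ring in question and a symbol $q_{i,j}$ whose index is out of range is read as $0$. Let $\partial_-=\partial_1-\partial_2$ on $\Lambda_q$, and let $\widehat\partial_{c-}=\partial_1-\partial_2+\partial_\psi+\partial'_\psi$ on $\widehat{\Lambda_q}$. Let $\widehat\rho:\widehat{\Lambda_q}\to\mathbb{Q}[\xi_n: n\ge -1][\phi,\phi^{-1}]$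 be the $\mathbb{Q}$-algebra homomorphism with $\phi\mapsto\phi$, $q_{0,2n}\mapsto \xi_n+\phi^n$ for $n\ge -1$, and $q_{i,j}\mapsto 0$ for $i>0$ (the extended inverse pullback map). For every integer $k\ge 1$, the element $$\widehat\rho\bigl(\widehat\partial_{c-}^{\,3k}(q_{3,1}^{2k})\bigr)\Big|_{\xi_{-1}=0,\ \xi_0=6k-4}$$ of $\mathbb{Q}[\xi_n:n\ge 0][\phi,\phi^{-1}]$ is independent of $\phi$, that is, it lies in $\mathbb{Q}[\xi_n:n\ge 0]$. It is equal to $\partial_-^{3k}(q_{3,1}^{2k})$ under the identification $q_{0,2n}=\xi_n$ for $n\ge 0$ (the algebra homomorphism with $\phi\mapsto\phi$, $q_{0,2n}\mapsto\xi_n$, and $q_{i,j}\mapsto 0$ for $i>0$). -/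

import Mathlib

open MvPolynomial

noncomputable section

namespace SurfaceGluing

/-- Indices `(i, j)` of the generators `q_{i,j}` of `Λ_q`: `i, j ≥ 0` and `i ≡ j (mod 2)`. -/
def qIndex : Set (ℤ × ℤ) := {p | 0 ≤ p.1 ∧ 0 ≤ p.2 ∧ p.1 ≡ p.2 [ZMOD 2]}

/-- Indices of the generators of the extended ring: those of `Λ_q`, together with `(0, -2)`
(the sphere) and `(1, -1)` (the disk). -/
def qIndexHat : Set (ℤ × ℤ) := qIndex ∪ {(0, -2), (1, -1)}

/-- The polynomial ring `ℚ[q_{i,j}, φ]` with `(i, j)` ranging over `S`. The variable `none` is `φ`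
and the variable `some (i, j)` is `q_{i,j}`. -/
abbrev QRing (S : Set (ℤ × ℤ)) : Type := MvPolynomial (Option S) ℚ

/-- The ring `Λ_q`. -/
abbrev LambdaQ : Type := QRing qIndex

/-- The ring `Λ_q` extended by `q_{0,-2}` and `q_{1,-1}`. -/
abbrev LambdaQHat : Type := QRing qIndexHat

/-- The variable `φ`. -/
def phi (S : Set (ℤ × ℤ)) : QRing S := X none

open Classical in
/-- The generator `q_{i,j}`, read as `0` when the index `(i, j)` is out of range. -/
def q (S : Set (ℤ × ℤ)) (i j : ℤ) : QRing S :=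
  if h : (i, j) ∈ S then X (some ⟨(i, j), h⟩) else 0

/-- The derivative `∂_{q_{i,j}}`. -/
def dq {S : Set (ℤ × ℤ)} (a : S) : QRing S →ₗ[ℚ] QRing S :=
  (pderiv (some a) : Derivation ℚ (QRing S) (QRing S)).toLinearMap

theorem dq_support_finite {S : Set (ℤ × ℤ)} (f : QRing S) : {a : S | dq a f ≠ 0}.Finite := by
  refine Set.Finite.subset
    ((f.vars.finite_toSet).preimage (f := (some : S → Option S))
      (Option.some_injective _).injOn) ?_
  intro a ha
  by_contra h
  exact ha (pderiv_eq_zero_of_notMem_vars h)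

/-- The sums defining the first order operators are finite. -/
theorem firstOrder_support_finite {S : Set (ℤ × ℤ)} (c : S → QRing S) (f : QRing S) :
    (Function.support fun a : S => c a * dq a f).Finite := by
  refine (dq_support_finite f).subset ?_
  intro a ha h
  exact ha (by simp [h])

/-- The sums defining the second order operators are finite. -/
theorem secondOrder_support_finite {S : Set (ℤ × ℤ)} (c : S → S → QRing S) (f : QRing S) :
    (Function.support fun p : S × S => c p.1 p.2 * dq p.1 (dq p.2 f)).Finite := by
  have hfin : (⋃ b ∈ {b : S | dq b f ≠ 0},
      (fun a : S => (a, b)) '' {a : S | dq a (dq b f) ≠ 0}).Finite :=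
    (dq_support_finite f).biUnion fun b _ => (dq_support_finite (dq b f)).image _
  refine hfin.subset ?_
  rintro ⟨a, b⟩ hab
  have h1 : dq a (dq b f) ≠ 0 := fun h => hab (by simp [h])
  have h2 : dq b f ≠ 0 := fun h => h1 (by simp [h])
  exact Set.mem_biUnion h2 ⟨a, h1, rfl⟩

/-- The operator `∑_a c_a ∂_{q_a}`. -/
def firstOrder {S : Set (ℤ × ℤ)} (c : S → QRing S) : Module.End ℚ (QRing S) where
  toFun f := ∑ᶠ a : S, c a * dq a f
  map_add' f g := by
    rw [← finsum_add_distrib (firstOrder_support_finite c f) (firstOrder_support_finite c g)]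
    simp only [map_add, mul_add]
  map_smul' r f := by
    rw [RingHom.id_apply, smul_finsum' r (firstOrder_support_finite c f)]
    simp only [map_smul, mul_smul_comm]

/-- The operator `∑_{a,b} c_{a,b} ∂_{q_a} ∂_{q_b}`, the sum being over ordered pairs. -/
def secondOrder {S : Set (ℤ × ℤ)} (c : S → S → QRing S) : Module.End ℚ (QRing S) where
  toFun f := ∑ᶠ p : S × S, c p.1 p.2 * dq p.1 (dq p.2 f)
  map_add' f g := by
    rw [← finsum_add_distrib (secondOrder_support_finite c f) (secondOrder_support_finite c g)]
    simp only [map_add, mul_add]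
  map_smul' r f := by
    rw [RingHom.id_apply, smul_finsum' r (secondOrder_support_finite c f)]
    simp only [map_smul, mul_smul_comm]

/-- The binomial coefficient `i choose 2 = i (i - 1) / 2` as a rational number. -/
def choose2 (i : ℤ) : ℚ := (i : ℚ) * ((i : ℚ) - 1) / 2

/-- One-component gluing: `∑ (i choose 2) q_{i-2,j} ∂_{q_{i,j}}`. -/
def glueOne (S : Set (ℤ × ℤ)) : Module.End ℚ (QRing S) :=
  firstOrder fun a => C (choose2 a.1.1) * q S (a.1.1 - 2) a.1.2

/-- Two-component gluing: `∑ (1/2) i k q_{i+k-2,j+l} ∂_{q_{i,j}} ∂_{q_{k,l}}`. -/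
def glueTwo (S : Set (ℤ × ℤ)) : Module.End ℚ (QRing S) :=
  secondOrder fun a b =>
    C ((1 / 2 : ℚ) * (a.1.1 : ℚ) * (b.1.1 : ℚ)) * q S (a.1.1 + b.1.1 - 2) (a.1.2 + b.1.2)

/-- One-component capping: `∑ (i choose 2) φ q_{i-2,j-2} ∂_{q_{i,j}}`. -/
def capOne (S : Set (ℤ × ℤ)) : Module.End ℚ (QRing S) :=
  firstOrder fun a => C (choose2 a.1.1) * phi S * q S (a.1.1 - 2) (a.1.2 - 2)

/-- Two-component capping: `∑ (1/2) i k φ q_{i-1,j-1} q_{k-1,l-1} ∂_{q_{i,j}} ∂_{q_{k,l}}`. -/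
def capTwo (S : Set (ℤ × ℤ)) : Module.End ℚ (QRing S) :=
  secondOrder fun a b =>
    C ((1 / 2 : ℚ) * (a.1.1 : ℚ) * (b.1.1 : ℚ)) * phi S *
      q S (a.1.1 - 1) (a.1.2 - 1) * q S (b.1.1 - 1) (b.1.2 - 1)

/-- The negative gluing operator `∂_- = ∂_1 - ∂_2` on `Λ_q`. -/
def gluingMinus : Module.End ℚ LambdaQ := glueOne qIndex - glueTwo qIndex

/-- The extended negative surface operator `∂_{c-} = ∂_1 - ∂_2 + ∂_ψ + ∂'_ψ` on the extended
ring. -/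
def surfaceMinusHat : Module.End ℚ LambdaQHat :=
  glueOne qIndexHat - glueTwo qIndexHat + capTwo qIndexHat + capOne qIndexHat

/-- `ℚ[ξ_n : n ≥ -1][φ, φ⁻¹]`; the Laurent variable is `φ`, so `φ ^ n` is `LaurentPolynomial.T n`
for every integer `n`. -/
abbrev LambdaXiHatInv : Type := LaurentPolynomial (MvPolynomial {n : ℤ // -1 ≤ n} ℚ)

/-- `ℚ[ξ_n : n ≥ 0][φ, φ⁻¹]`, with the same convention. -/
abbrev LambdaXiInv : Type := LaurentPolynomial (MvPolynomial ℕ ℚ)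

theorem neg_one_le_half {j : ℤ} (h : ((0 : ℤ), j) ∈ qIndexHat) : -1 ≤ j / 2 := by
  rcases h with h | h | h
  · have := h.2.1
    simp only at this
    omega
  · simp only [Prod.mk.injEq] at h
    omega
  · simp at h

/-- The extended inverse pullback map, the algebra homomorphism with `φ ↦ φ` and
`q_{0,2n} ↦ ξ_n + φ ^ n` for all `n ≥ -1`; the generators `q_{i,j}` with `i ≠ 0` go to `0`. -/
def pullbackHat : LambdaQHat →ₐ[ℚ] LambdaXiHatInv :=
  aeval fun v => match v with
    | none => LaurentPolynomial.T 1
    | some ⟨(i, j), h⟩ =>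
      if hi : i = 0 then
        LaurentPolynomial.C (X ⟨j / 2, neg_one_le_half (hi ▸ h)⟩) + LaurentPolynomial.T (j / 2)
      else 0

/-- The evaluation `ξ_{-1} ↦ 0`, `ξ_0 ↦ c`, `ξ_n ↦ ξ_n` for `n ≥ 1`, `φ ↦ φ`. -/
def evalXi (c : ℚ) : LambdaXiHatInv →ₐ[ℚ] LambdaXiInv :=
  AddMonoidAlgebra.mapAlgHom ℤ
    (aeval fun n : {n : ℤ // -1 ≤ n} =>
      if n.1 = -1 then (0 : MvPolynomial ℕ ℚ) else if n.1 = 0 then C c else X n.1.toNat)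

/-- The identification of `q_{0,2n}` with `ξ_n` for all `n ≥ 0`: the algebra homomorphism with
`φ ↦ φ` and `q_{0,2n} ↦ ξ_n`; the generators `q_{i,j}` with `i ≠ 0` go to `0`. -/
def qToXi : LambdaQ →ₐ[ℚ] LambdaXiInv :=
  aeval fun v => match v with
    | none => LaurentPolynomial.T 1
    | some ⟨(i, j), _⟩ =>
      if i = 0 then LaurentPolynomial.C (X (j / 2).toNat) else 0

end SurfaceGluing

end

/-!
Both sides are total contractions of a power of a cubic form by a Laplacian, on two quadratic spaces
that differ by a hyperbolic plane.

Informally, put `q_{i,j} = -∑_a σ_a ^ j x_a ^ i`, with coordinates `x_a` indexed by a finite set. The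
operator `∂_1 - ∂_2` is then half the Laplacian in the `x_a`, and the capping terms are `φ / 2` times
the square of the derivative along the vector with components `1 / σ_a`. After the substitution
`q_{0,2n} = ξ_n + φ ^ n`, the element `-φ ^ n` is the contribution to `ξ_n` of one more coordinate
`x_0` with `σ_0 ^ 2 = φ`; the condition `ξ_{-1} = 0` says that the vector with components `1 / σ_a`
in all coordinates, `x_0` included, is isotropic. Consequently the capped operator is the Laplacian of
the orthogonal complement of a hyperbolic plane with coordinates `u`, `v`, while the gluing operator
is the Laplacian of the whole space. The condition `ξ_0 = 6 k - 4` says that this complement has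
dimension `2 - 2 m` with `m = 3 k`.

Since dimensions are negative, coordinates are not used: the spaces are replaced by a polynomial ring
(`ModelRing`) in symbols `s_{i,e}` for the power sums and one coordinate `z`, in which the dimension is
a scalar. All operators are of second order, so identities between them need to be checked only on
generators and on products of two generators (`IsSecondOrder.intertwine_pow`,
`IsSecondOrder.mvPolynomial_ext`).

Along the isotropic direction the cubic form is `w + 3 (u y - u² v)`, where `-y` is the squared norm on
the complement and `w` does not depend on `u`. Expanding the `2 k`-th power, Wick's rule for `u`
(`HyperbolicSplitting.contract_u_pow`) and the commutation relation of the Laplacian with `y`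
(`HyperbolicSplitting.cap_pow_y`) turn the coefficient of `w ^ (2 k - j)` into a multiple of
`∑ (j choose a) 2 ^ a (-1) ^ (j - a) (2 j - a)`, which vanishes for `j ≥ 1`
(`HyperbolicSplitting.contract_mixed`). What remains is the contraction on the complement
(`HyperbolicSplitting.contract_cubic`).

On the gluing side neither `φ` nor `q_{0,0}` can appear: the symbols reached from `q_{3,1}` have second
index at least `1` (`fullHom_gluingMinus_pow`). This gives independence of `φ`.
-/

open MvPolynomial

namespace SurfaceGluing

/-! ### Differential operators of order two -/

section SecondOrder

variable {R A B : Type*} [CommRing R] [CommRing A] [Algebra R A] [CommRing B] [Algebra R B]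

theorem moduleEnd_natCast_mul (f : Module.End R A) (n : ℕ) (x : A) : f (n * x) = n * f x := by
  rw [← nsmul_eq_mul, map_nsmul, nsmul_eq_mul]

theorem derivation_natCast_mul (d : Derivation R A A) (n : ℕ) (x : A) : d (n * x) = n * d x := by
  rw [← nsmul_eq_mul, map_nsmul, nsmul_eq_mul]

/-- A linear endomorphism of a commutative algebra is a differential operator of order at most two
that kills the constants. The condition says that the bracket
`Δ (x * y) - x * Δ y - y * Δ x` is a derivation in each argument. -/
def IsSecondOrder (Δ : Module.End R A) : Prop :=
  ∀ x y z : A, Δ (x * y * z) = x * Δ (y * z) + y * Δ (x * z) + z * Δ (x * y)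
    - x * y * Δ z - x * z * Δ y - y * z * Δ x

namespace IsSecondOrder

variable {Δ Δ' : Module.End R A}

theorem map_one (h : IsSecondOrder Δ) : Δ 1 = 0 := by
  have := h 1 1 1
  simp only [mul_one, one_mul] at this
  linear_combination this

theorem add (h : IsSecondOrder Δ) (h' : IsSecondOrder Δ') : IsSecondOrder (Δ + Δ') := by
  intro x y z
  simp only [LinearMap.add_apply]
  linear_combination h x y z + h' x y z

theorem sub (h : IsSecondOrder Δ) (h' : IsSecondOrder Δ') : IsSecondOrder (Δ - Δ') := by
  intro x y z
  simp only [LinearMap.sub_apply]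
  linear_combination h x y z - h' x y z

theorem smul (r : R) (h : IsSecondOrder Δ) : IsSecondOrder (r • Δ) := by
  intro x y z
  simp only [LinearMap.smul_apply, h x y z, smul_sub, smul_add, mul_smul_comm]

theorem mulLeft (a : A) (h : IsSecondOrder Δ) :
    IsSecondOrder (LinearMap.mulLeft R a * Δ) := by
  intro x y z
  simp only [Module.End.mul_apply, LinearMap.mulLeft_apply, h x y z]
  ring

theorem sum {ι : Type*} (s : Finset ι) (Δ : ι → Module.End R A)
    (h : ∀ i ∈ s, IsSecondOrder (Δ i)) : IsSecondOrder (∑ i ∈ s, Δ i) := by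
  classical
  induction s using Finset.induction_on with
  | empty => intro x y z; simp
  | insert i s hi ih =>
    rw [Finset.sum_insert hi]
    exact (h i (by simp)).add (ih fun j hj => h j (by simp [hj]))

/-- A derivation into a module, followed by a first order operator out of that module. -/
theorem comp_derivation {M : Type*} [AddCommGroup M] [Module A M] [Module R M]
    (d : Derivation R A M) (P : M →ₗ[R] A)
    (hP : ∀ (x y : A) (w : M),
      P (x • y • w) = x * P (y • w) + y * P (x • w) - x * y * P w) :
    IsSecondOrder (P ∘ₗ d.toLinearMap) := by
  intro x y z
  have h1 : d (x * y * z) = x • y • d z + x • z • d y + y • z • d x := by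
    rw [d.leibniz, d.leibniz, smul_add, mul_smul, smul_comm z x, smul_comm z y, add_assoc]
  simp only [LinearMap.comp_apply, Derivation.coeFn_coe, h1,
    d.leibniz, map_add, hP]
  ring

theorem derivation_mul (d d' : Derivation R A A) :
    IsSecondOrder ((d.toLinearMap : Module.End R A) * d'.toLinearMap) := by
  refine comp_derivation d' d.toLinearMap fun x y w => ?_
  simp only [Derivation.coeFn_coe, smul_eq_mul, d.leibniz]
  ring

theorem of_derivation (d : Derivation R A A) : IsSecondOrder (d.toLinearMap : Module.End R A) := by
  intro x y z
  simp only [Derivation.coeFn_coe, smul_eq_mul, d.leibniz]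
  ring

/-- The commutator with a derivation does not raise the order. -/
theorem commutator (h : IsSecondOrder Δ) (d : Derivation R A A) :
    IsSecondOrder (Δ * d.toLinearMap - d.toLinearMap * Δ) := by
  intro x y z
  have e1 := h (d x) y z
  have e2 := h x (d y) z
  have e3 := h x y (d z)
  simp only [LinearMap.sub_apply, Module.End.mul_apply, 
    Derivation.coeFn_coe, smul_eq_mul, d.leibniz, map_add, h x y z, map_sub, mul_add] at *
  simp only [mul_comm, mul_left_comm, mul_assoc] at *
  linear_combination e1 + e2 + e3

/-- The bracket `Δ (x * y) - x * Δ y - y * Δ x`, as a derivation in `y`. -/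
def bracket (h : IsSecondOrder Δ) (x : A) : Derivation R A A where
  toLinearMap := Δ ∘ₗ LinearMap.mulLeft R x - LinearMap.mulLeft R x ∘ₗ Δ -
    LinearMap.mulRight R (Δ x)
  map_one_eq_zero' := by
    simp [h.map_one]
  leibniz' a b := by
    have := h x a b
    simp only [LinearMap.sub_apply, LinearMap.comp_apply, LinearMap.mulLeft_apply,
      LinearMap.mulRight_apply, smul_eq_mul, ← mul_assoc]
    linear_combination this

theorem bracket_apply (h : IsSecondOrder Δ) (x y : A) :
    h.bracket x y = Δ (x * y) - x * Δ y - y * Δ x := rfl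

theorem map_mul (h : IsSecondOrder Δ) (x y : A) :
    Δ (x * y) = x * Δ y + y * Δ x + h.bracket x y := by
  rw [bracket_apply]; ring

theorem bracket_comm (h : IsSecondOrder Δ) (x y : A) : h.bracket x y = h.bracket y x := by
  rw [bracket_apply, bracket_apply, mul_comm x y]; ring

theorem restrictScalars {R' : Type*} [CommRing R'] [Algebra R' A] [Algebra R' R]
    [IsScalarTower R' R A] (h : IsSecondOrder Δ) :
    IsSecondOrder (Δ.restrictScalars R' : Module.End R' A) := h

/-- Whether an operator has order at most two is decided on finite sets of elements. -/
theorem of_local (h : ∀ F : Finset A, ∃ Δ' : Module.End R A, IsSecondOrder Δ' ∧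
    ∀ x ∈ F, Δ x = Δ' x) : IsSecondOrder Δ := by
  classical
  intro x y z
  obtain ⟨Δ', h', e⟩ := h {x * y * z, y * z, x * z, x * y, x, y, z}
  simp only [Finset.mem_insert, Finset.mem_singleton, forall_eq_or_imp, forall_eq] at e
  obtain ⟨e1, e2, e3, e4, e5, e6, e7⟩ := e
  rw [e1, e2, e3, e4, e5, e6, e7, h']

/-- Operators of order two intertwined by `f` on generators and on products of two generators are
intertwined on the subalgebra generated. -/
theorem intertwine {Δ' : Module.End R B} (h : IsSecondOrder Δ) (h' : IsSecondOrder Δ')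
    (f : A →ₐ[R] B) (s : Set A) (h1 : ∀ x ∈ s, f (Δ x) = Δ' (f x))
    (h2 : ∀ x ∈ s, ∀ y ∈ s, f (Δ (x * y)) = Δ' (f (x * y)))
    {x : A} (hx : x ∈ Algebra.adjoin R s) : f (Δ x) = Δ' (f x) := by
  -- On monomials, induct on the length, splitting off two generators by the three-term identity.
  have key : ∀ y ∈ Submonoid.closure s,
      f (Δ y) = Δ' (f y) ∧ ∀ t ∈ s, f (Δ (t * y)) = Δ' (f (t * y)) := by
    intro y hy
    induction hy using Submonoid.closure_induction_left with
    | one => simpa [h.map_one, h'.map_one] using h1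
    | mul_left t ht y hy ih =>
      refine ⟨ih.2 t ht, fun r hr => ?_⟩
      rw [← mul_assoc, h, _root_.map_mul f, _root_.map_mul f, h']
      simp only [map_add, map_sub, _root_.map_mul f]
      simp only [← _root_.map_mul f, ih.1, ih.2 t ht, ih.2 r hr, h1 t ht, h1 r hr, h2 r hr t ht]
  rw [← Subalgebra.mem_toSubmodule, Algebra.adjoin_eq_span] at hx
  induction hx using Submodule.span_induction with
  | mem y hy => exact (key y hy).1
  | zero => simp
  | add a b _ _ ha hb => simp only [map_add, ha, hb]
  | smul r a _ ha => simp only [map_smul, ha]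

/-- An operator of order two preserves the subalgebra generated by `s` if it maps the elements of
`s` and the products of two of them into it. -/
theorem mem_adjoin (h : IsSecondOrder Δ) (s : Set A)
    (h1 : ∀ x ∈ s, Δ x ∈ Algebra.adjoin R s)
    (h2 : ∀ x ∈ s, ∀ y ∈ s, Δ (x * y) ∈ Algebra.adjoin R s)
    {x : A} (hx : x ∈ Algebra.adjoin R s) : Δ x ∈ Algebra.adjoin R s := by
  have key : ∀ y ∈ Submonoid.closure s,
      y ∈ Algebra.adjoin R s ∧ Δ y ∈ Algebra.adjoin R s ∧
        ∀ t ∈ s, Δ (t * y) ∈ Algebra.adjoin R s := by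
    intro y hy
    induction hy using Submonoid.closure_induction_left with
    | one => simpa [h.map_one, one_mem] using h1
    | mul_left t ht y hy ih =>
      have hs : ∀ t ∈ s, t ∈ Algebra.adjoin R s := fun t ht => Algebra.subset_adjoin ht
      refine ⟨mul_mem (hs t ht) ih.1, ih.2.2 t ht, fun r hr => ?_⟩
      rw [← mul_assoc, h]
      exact sub_mem (sub_mem (sub_mem (add_mem (add_mem (mul_mem (hs r hr) (ih.2.2 t ht))
        (mul_mem (hs t ht) (ih.2.2 r hr))) (mul_mem ih.1 (h2 r hr t ht)))
        (mul_mem (mul_mem (hs r hr) (hs t ht)) ih.2.1))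
        (mul_mem (mul_mem (hs r hr) ih.1) (h1 t ht)))
        (mul_mem (mul_mem (hs t ht) ih.1) (h1 r hr))
  rw [← Subalgebra.mem_toSubmodule, Algebra.adjoin_eq_span] at hx
  induction hx using Submodule.span_induction with
  | mem y hy => exact (key y hy).2.1
  | zero => simp
  | add a b _ _ ha hb => rw [map_add]; exact add_mem ha hb
  | smul r a _ ha => rw [map_smul]; exact Subalgebra.smul_mem _ ha r

theorem intertwine_pow {Δ' : Module.End R B} (h : IsSecondOrder Δ) (h' : IsSecondOrder Δ')
    (f : A →ₐ[R] B) (s : Set A)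
    (hs1 : ∀ x ∈ s, Δ x ∈ Algebra.adjoin R s)
    (hs2 : ∀ x ∈ s, ∀ y ∈ s, Δ (x * y) ∈ Algebra.adjoin R s)
    (h1 : ∀ x ∈ s, f (Δ x) = Δ' (f x))
    (h2 : ∀ x ∈ s, ∀ y ∈ s, f (Δ (x * y)) = Δ' (f (x * y)))
    (n : ℕ) {x : A} (hx : x ∈ Algebra.adjoin R s) :
    (Δ ^ n) x ∈ Algebra.adjoin R s ∧ f ((Δ ^ n) x) = (Δ' ^ n) (f x) := by
  induction n with
  | zero => simpa using hx
  | succ n ih =>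
    rw [pow_succ', pow_succ', Module.End.mul_apply, Module.End.mul_apply, ← ih.2]
    exact ⟨h.mem_adjoin s hs1 hs2 ih.1, h.intertwine h' f s h1 h2 ih.1⟩

end IsSecondOrder

/-- Operators of order two on a polynomial ring agree if they agree on the variables and on the
products of two variables. -/
theorem IsSecondOrder.mvPolynomial_ext {σ : Type*} {Δ Δ' : Module.End R (MvPolynomial σ R)}
    (h : IsSecondOrder Δ) (h' : IsSecondOrder Δ') (h1 : ∀ i, Δ (X i) = Δ' (X i))
    (h2 : ∀ i j, Δ (X i * X j) = Δ' (X i * X j)) : Δ = Δ' := by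
  refine LinearMap.ext fun x => ?_
  refine h.intertwine h' (AlgHom.id R _) (Set.range X) ?_ ?_
    (by rw [adjoin_range_X]; trivial)
  · rintro _ ⟨i, rfl⟩; exact h1 i
  · rintro _ ⟨i, rfl⟩ _ ⟨j, rfl⟩; exact h2 i j

section Construction

variable {σ : Type*}

/-- The differential operator `∑ α_a ∂_a + ∑ β_{a,b} ∂_a ∂_b` on a polynomial ring, the second sum
running over ordered pairs. -/
noncomputable def secondOrderOp (α : σ → MvPolynomial σ R) (β : σ → σ → MvPolynomial σ R) :
    Module.End R (MvPolynomial σ R) :=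
  (mkDerivation R α).toLinearMap +
    Finsupp.lsum R (fun b => (mkDerivation R fun a => β a b).toLinearMap) ∘ₗ
      (mkDerivation R fun b => Finsupp.single b (1 : MvPolynomial σ R)).toLinearMap

variable (α : σ → MvPolynomial σ R) (β : σ → σ → MvPolynomial σ R)

theorem isSecondOrder_secondOrderOp : IsSecondOrder (secondOrderOp α β) := by
  refine (IsSecondOrder.of_derivation _).add (IsSecondOrder.comp_derivation _ _ fun x y w => ?_)
  induction w using Finsupp.induction_linear with
  | zero => simp
  | add v w hv hw => simp only [smul_add, map_add, hv, hw]; ring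
  | single b w =>
    simp only [Finsupp.smul_single, smul_eq_mul, Finsupp.lsum_single,
      Derivation.coeFn_coe, Derivation.leibniz]
    ring

theorem secondOrderOp_X (a : σ) : secondOrderOp α β (X a) = α a := by
  simp [secondOrderOp, mkDerivation_X]

theorem secondOrderOp_X_mul_X (a b : σ) :
    secondOrderOp α β (X a * X b) = X a * α b + X b * α a + (β a b + β b a) := by
  simp only [secondOrderOp, LinearMap.add_apply, LinearMap.comp_apply, Derivation.coeFn_coe,
    Derivation.leibniz, mkDerivation_X, map_add, Finsupp.smul_single, smul_eq_mul,
    Finsupp.lsum_single, mul_one]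

end Construction

end SecondOrder

/-! ### The gluing and capping operators on generators -/

section FrozenOperators

variable {S : Set (ℤ × ℤ)}

theorem isSecondOrder_firstOrder (c : S → QRing S) : IsSecondOrder (firstOrder c) := by
  classical
  refine IsSecondOrder.of_local fun F => ?_
  have hfin : (⋃ f ∈ (F : Set (QRing S)), Function.support fun a : S => c a * dq a f).Finite :=
    F.finite_toSet.biUnion fun f _ => firstOrder_support_finite c f
  refine ⟨∑ a ∈ hfin.toFinset, LinearMap.mulLeft ℚ (c a) * dq a,
    IsSecondOrder.sum _ _ fun a _ => (IsSecondOrder.of_derivation _).mulLeft _, fun f hf => ?_⟩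
  rw [LinearMap.sum_apply]
  refine finsum_eq_sum_of_support_subset _ fun a ha => ?_
  simp only [Set.Finite.coe_toFinset, Set.mem_iUnion]
  exact ⟨f, hf, ha⟩

theorem isSecondOrder_secondOrder (c : S → S → QRing S) : IsSecondOrder (secondOrder c) := by
  classical
  refine IsSecondOrder.of_local fun F => ?_
  have hfin : (⋃ f ∈ (F : Set (QRing S)),
      Function.support fun p : S × S => c p.1 p.2 * dq p.1 (dq p.2 f)).Finite :=
    F.finite_toSet.biUnion fun f _ => secondOrder_support_finite c f
  refine ⟨∑ p ∈ hfin.toFinset, LinearMap.mulLeft ℚ (c p.1 p.2) * (dq p.1 * dq p.2),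
    IsSecondOrder.sum _ _ fun p _ => (IsSecondOrder.derivation_mul _ _).mulLeft _,
    fun f hf => ?_⟩
  rw [LinearMap.sum_apply]
  refine finsum_eq_sum_of_support_subset _ fun a ha => ?_
  simp only [Set.Finite.coe_toFinset, Set.mem_iUnion]
  exact ⟨f, hf, ha⟩

open Classical in
theorem dq_X (a : S) (v : Option S) :
    dq a (X v : QRing S) = if v = some a then 1 else 0 := by
  change pderiv (some a) (X v) = _
  rw [pderiv_X, Pi.single_apply]

theorem dq_mul (a : S) (f g : QRing S) : dq a (f * g) = f * dq a g + g * dq a f := by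
  change pderiv (some a) (f * g) = _
  rw [Derivation.leibniz]
  rfl

theorem dq_one (a : S) : dq a (1 : QRing S) = 0 := by
  change pderiv (some a) 1 = _
  simp

theorem firstOrder_X_some (c : S → QRing S) (a : S) : firstOrder c (X (some a)) = c a := by
  change ∑ᶠ b : S, c b * dq b (X (some a)) = c a
  rw [finsum_eq_single _ a fun b hb => ?_]
  · simp [dq_X]
  · rw [dq_X, if_neg (by simpa using hb.symm), mul_zero]

theorem firstOrder_X_none (c : S → QRing S) : firstOrder c (X none) = 0 := by
  change ∑ᶠ b : S, c b * dq b (X none) = 0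
  simp [dq_X]

theorem firstOrder_mul (c : S → QRing S) (f g : QRing S) :
    firstOrder c (f * g) = f * firstOrder c g + g * firstOrder c f := by
  change ∑ᶠ b : S, c b * dq b (f * g) = f * ∑ᶠ b : S, c b * dq b g + g * ∑ᶠ b : S, c b * dq b f
  rw [mul_finsum' _ _ (firstOrder_support_finite c g), mul_finsum' _ _ (firstOrder_support_finite c f),
    ← finsum_add_distrib]
  · exact finsum_congr fun b => by rw [dq_mul]; ring
  · refine (firstOrder_support_finite c g).subset fun a ha h => ha ?_
    simp only at h ⊢
    rw [h, mul_zero]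
  · refine (firstOrder_support_finite c f).subset fun a ha h => ha ?_
    simp only at h ⊢
    rw [h, mul_zero]

theorem secondOrder_X (c : S → S → QRing S) (v : Option S) : secondOrder c (X v) = 0 := by
  classical
  change ∑ᶠ p : S × S, c p.1 p.2 * dq p.1 (dq p.2 (X v)) = 0
  refine finsum_eq_zero_of_forall_eq_zero fun p => ?_
  rw [dq_X]
  split_ifs <;> simp [dq_one]

theorem secondOrder_X_none_mul_X (c : S → S → QRing S) (v : Option S) :
    secondOrder c (X none * X v) = 0 := by
  classical
  change ∑ᶠ p : S × S, c p.1 p.2 * dq p.1 (dq p.2 (X none * X v)) = 0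
  refine finsum_eq_zero_of_forall_eq_zero fun p => ?_
  rw [dq_mul, dq_X, dq_X]
  split_ifs <;> simp_all [dq_X]

theorem secondOrder_X_some_mul_X_some (c : S → S → QRing S) (a b : S) :
    secondOrder c (X (some a) * X (some b)) = c a b + c b a := by
  classical
  -- The two points of the support coincide when `a = b`, so they are kept as two separate summands.
  have key : ∀ p : S × S, c p.1 p.2 * dq p.1 (dq p.2 (X (some a) * X (some b))) =
      (if p = (a, b) then c a b else 0) + (if p = (b, a) then c b a else 0) := by
    rintro ⟨r, s⟩
    rw [dq_mul, map_add, dq_mul, dq_mul]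
    simp only [dq_X, Option.some.injEq, Prod.mk.injEq]
    by_cases h1 : b = s <;> by_cases h2 : a = s <;> by_cases h3 : b = r <;> by_cases h4 : a = r <;>
      simp_all [dq_one, eq_comm, mul_add]
  change ∑ᶠ p : S × S, c p.1 p.2 * dq p.1 (dq p.2 (X (some a) * X (some b))) = _
  rw [finsum_congr key, finsum_add_distrib, finsum_eq_single _ (a, b), finsum_eq_single _ (b, a)]
  · simp
  · intro p hp; rw [if_neg hp]
  · intro p hp; rw [if_neg hp]
  · exact (Set.finite_singleton (a, b)).subset fun p hp => by
      by_contra h; exact hp (if_neg h)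
  · exact (Set.finite_singleton (b, a)).subset fun p hp => by
      by_contra h; exact hp (if_neg h)

theorem isSecondOrder_gluingMinus : IsSecondOrder gluingMinus :=
  (isSecondOrder_firstOrder _).sub (isSecondOrder_secondOrder _)

theorem isSecondOrder_surfaceMinusHat : IsSecondOrder surfaceMinusHat :=
  (((isSecondOrder_firstOrder _).sub (isSecondOrder_secondOrder _)).add
    (isSecondOrder_secondOrder _)).add (isSecondOrder_firstOrder _)

theorem gluingMinus_X_some (a : qIndex) : gluingMinus (X (some a)) =
    C (choose2 a.1.1) * q qIndex (a.1.1 - 2) a.1.2 := by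
  simp only [gluingMinus, glueOne, glueTwo, LinearMap.sub_apply, firstOrder_X_some, secondOrder_X,
    sub_zero]

theorem gluingMinus_X_mul_X (a b : qIndex) : gluingMinus (X (some a) * X (some b)) =
    X (some a) * gluingMinus (X (some b)) + X (some b) * gluingMinus (X (some a)) -
      C ((a.1.1 : ℚ) * b.1.1) * q qIndex (a.1.1 + b.1.1 - 2) (a.1.2 + b.1.2) := by
  simp only [gluingMinus, glueOne, glueTwo, LinearMap.sub_apply, firstOrder_X_some, secondOrder_X,
    sub_zero, firstOrder_mul, secondOrder_X_some_mul_X_some, add_comm b.1.1 a.1.1,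
    add_comm b.1.2 a.1.2, ← add_mul, ← C_add]
  rw [show (1 / 2 : ℚ) * a.1.1 * b.1.1 + 1 / 2 * b.1.1 * a.1.1 = a.1.1 * b.1.1 by ring]

theorem surfaceMinusHat_X_none : surfaceMinusHat (X none) = 0 := by
  simp only [surfaceMinusHat, glueOne, glueTwo, capOne, capTwo, LinearMap.sub_apply,
    LinearMap.add_apply, firstOrder_X_none, secondOrder_X, sub_zero, add_zero]

theorem surfaceMinusHat_X_none_mul_X (v : Option qIndexHat) :
    surfaceMinusHat (X none * X v) = X none * surfaceMinusHat (X v) := by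
  simp only [surfaceMinusHat, glueOne, glueTwo, capOne, capTwo, LinearMap.sub_apply,
    LinearMap.add_apply, firstOrder_mul, firstOrder_X_none, secondOrder_X_none_mul_X,
    secondOrder_X, sub_zero, add_zero, mul_zero, mul_add]

theorem surfaceMinusHat_X_some (a : qIndexHat) : surfaceMinusHat (X (some a)) =
    C (choose2 a.1.1) * (q qIndexHat (a.1.1 - 2) a.1.2 +
      X none * q qIndexHat (a.1.1 - 2) (a.1.2 - 2)) := by
  simp only [surfaceMinusHat, glueOne, glueTwo, capOne, capTwo, LinearMap.sub_apply, phi,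
    LinearMap.add_apply, firstOrder_X_some, secondOrder_X, sub_zero, add_zero]
  ring

theorem surfaceMinusHat_X_mul_X (a b : qIndexHat) :
    surfaceMinusHat (X (some a) * X (some b)) =
    X (some a) * surfaceMinusHat (X (some b)) + X (some b) * surfaceMinusHat (X (some a)) +
      C ((a.1.1 : ℚ) * b.1.1) * (X none * q qIndexHat (a.1.1 - 1) (a.1.2 - 1) *
        q qIndexHat (b.1.1 - 1) (b.1.2 - 1) -
          q qIndexHat (a.1.1 + b.1.1 - 2) (a.1.2 + b.1.2)) := by
  have h2 : (C (a.1.1 * b.1.1 : ℚ) : LambdaQHat) = C ((1 / 2 : ℚ) * a.1.1 * b.1.1) +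
      C ((1 / 2 : ℚ) * b.1.1 * a.1.1) := by
    rw [← C_add]; congr 1; ring
  simp only [surfaceMinusHat, glueOne, glueTwo, capOne, capTwo, LinearMap.sub_apply, phi,
    LinearMap.add_apply, firstOrder_X_some, secondOrder_X, sub_zero, add_zero,
    firstOrder_mul, secondOrder_X_some_mul_X_some, add_comm b.1.1 a.1.1,
    add_comm b.1.2 a.1.2, h2]
  ring

end FrozenOperators

/-! ### The model ring -/

section Model

variable {K : Type*} [CommRing K]

variable (K) in
/-- The model ring `K[s_{i,e}, z : i ≥ 1, e ∈ ℤ]`. The variable `some (n, e)` stands for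
`s_{n+1,e}`, the image of `q_{i,j}` with `i = n + 1` and `j - i = 2 e`; the variable `none` is the
additional coordinate `z`. -/
abbrev ModelRing : Type _ := MvPolynomial (Option (ℕ × ℤ)) K

/-- The element `s_{i,e}` of the model ring; for `i = 0` it is the scalar `c e`. -/
noncomputable def modelS (c : ℤ → K) : ℕ → ℤ → ModelRing K
  | 0, e => C (c e)
  | n + 1, e => X (some (n, e))

/-- The coordinate `z` of the model ring. -/
noncomputable def modelZ : ModelRing K := X none

variable (c : ℤ → K)

/-- The derivation `s_{i,e} ↦ i s_{i-1,e}`, `z ↦ 0`; half its square times `φ` is the capping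
operator. -/
noncomputable def modelShift : Derivation K (ModelRing K) (ModelRing K) :=
  mkDerivation K fun v => match v with
    | none => 0
    | some (n, e) => ((n : ModelRing K) + 1) * modelS c n e

/-- The derivation `∂ / ∂ z`. -/
noncomputable def modelDz : Derivation K (ModelRing K) (ModelRing K) := pderiv none

/-- The derivation counting degrees, where `s_{i,e}` has degree `i` and `z` has degree `1`. -/
noncomputable def modelEuler : Derivation K (ModelRing K) (ModelRing K) :=
  mkDerivation K fun v => match v with
    | none => X none
    | some (n, e) => ((n : ModelRing K) + 1) * X (some (n, e))

theorem modelS_succ (n : ℕ) (e : ℤ) : modelS c (n + 1) e = X (some (n, e)) := rfl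

theorem modelS_zero (e : ℤ) : modelS c 0 e = C (c e) := rfl

theorem derivation_C (d : Derivation K (ModelRing K) (ModelRing K)) (a : K) : d (C a) = 0 :=
  d.map_algebraMap a

theorem modelShift_modelS (n : ℕ) (e : ℤ) :
    modelShift c (modelS c n e) = n * modelS c (n - 1) e := by
  cases n with
  | zero => simp [modelS_zero]
  | succ n => simp [modelS_succ, modelShift, mkDerivation_X]

theorem modelShift_modelZ : modelShift c modelZ = 0 := by
  simp [modelShift, modelZ, mkDerivation_X]

theorem modelDz_modelS (n : ℕ) (e : ℤ) : modelDz (modelS c n e) = 0 := by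
  cases n with
  | zero => rw [modelS_zero, derivation_C]
  | succ n => simp [modelS_succ, modelDz, pderiv_X]

theorem modelDz_modelZ : modelDz (modelZ : ModelRing K) = 1 := by
  simp [modelDz, modelZ]

theorem modelEuler_modelS (n : ℕ) (e : ℤ) :
    modelEuler (modelS c n e) = n * modelS c n e := by
  cases n with
  | zero => simp [modelS_zero]
  | succ n => simp [modelS_succ, modelEuler, mkDerivation_X]

theorem modelEuler_modelZ : modelEuler (modelZ : ModelRing K) = modelZ := by
  simp [modelEuler, modelZ, mkDerivation_X]

/-- Derivations of the model ring agree if they agree on the `s_{i,e}` and on `z`. -/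
theorem modelRing_derivation_ext {d d' : Derivation K (ModelRing K) (ModelRing K)}
    (hs : ∀ n e, d (modelS c n e) = d' (modelS c n e)) (hz : d modelZ = d' modelZ) : d = d' := by
  refine derivation_ext fun v => ?_
  rcases v with _ | ⟨n, e⟩
  · exact hz
  · exact hs (n + 1) e

theorem modelRing_map_C_mul {Δ : Module.End K (ModelRing K)} (a : K) (x : ModelRing K) :
    Δ (C a * x) = C a * Δ x := by
  rw [← smul_eq_C_mul, ← smul_eq_C_mul, map_smul]

theorem IsSecondOrder.map_C {Δ : Module.End K (ModelRing K)} (h : IsSecondOrder Δ) (a : K) :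
    Δ (C a) = 0 := by
  rw [← mul_one (C a), modelRing_map_C_mul, h.map_one, mul_zero]

theorem IsSecondOrder.bracket_C {Δ : Module.End K (ModelRing K)} (h : IsSecondOrder Δ) (a : K)
    (x : ModelRing K) : h.bracket (C a) x = 0 := by
  rw [h.bracket_apply, h.map_C, modelRing_map_C_mul]; ring

theorem IsSecondOrder.bracket_natCast_mul {Δ : Module.End K (ModelRing K)} (h : IsSecondOrder Δ)
    (n : ℕ) (x y : ModelRing K) : h.bracket (n * x) y = n * h.bracket x y := by
  rw [h.bracket_comm, derivation_natCast_mul, h.bracket_comm]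

theorem IsSecondOrder.bracket_zero_left {Δ : Module.End K (ModelRing K)} (h : IsSecondOrder Δ)
    (y : ModelRing K) : h.bracket 0 y = 0 := by
  rw [h.bracket_comm, map_zero]

variable [Algebra ℚ K]

variable (K) in
/-- The rational number `1 / 2` in `K`. -/
noncomputable def half : K := algebraMap ℚ K (1 / 2)

theorem half_mul_two : half K * 2 = 1 := by
  rw [half, ← map_ofNat (algebraMap ℚ K) 2, ← map_mul]; norm_num

theorem C_half_mul_two : (C (half K) : ModelRing K) * 2 = 1 := by
  rw [← map_ofNat (C : K →+* ModelRing K) 2, ← C_mul, half_mul_two, C_1]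

/-- The gluing operator `∂_1 - ∂_2` in the variables `s_{i,e}`. -/
noncomputable def modelGlue : Module.End K (ModelRing K) :=
  secondOrderOp
    (fun v => match v with
      | none => 0
      | some (n, e) => C (half K) * (((n : ModelRing K) + 1) * (n : ModelRing K)) * modelS c (n - 1) (e + 1))
    (fun v w => match v, w with
      | some (n, e), some (n', e') =>
        -C (half K) * (((n : ModelRing K) + 1) * ((n' : ModelRing K) + 1)) * modelS c (n + n') (e + e' + 1)
      | _, _ => 0)

theorem isSecondOrder_modelGlue : IsSecondOrder (modelGlue c) := isSecondOrder_secondOrderOp _ _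

theorem modelGlue_modelS (n : ℕ) (e : ℤ) :
    modelGlue c (modelS c n e) = C (half K) * ((n : ModelRing K) * ((n : ModelRing K) - 1)) * modelS c (n - 2) (e + 1) := by
  cases n with
  | zero => simp [modelS_zero, (isSecondOrder_modelGlue c).map_C]
  | succ n =>
    rw [modelS_succ, modelGlue, secondOrderOp_X]
    simp

theorem modelGlue_modelZ : modelGlue c modelZ = 0 := secondOrderOp_X _ _ _

theorem modelGlue_bracket_modelS (n n' : ℕ) (e e' : ℤ) :
    (isSecondOrder_modelGlue c).bracket (modelS c n e) (modelS c n' e') =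
      -(n * n') * modelS c (n + n' - 2) (e + e' + 1) := by
  cases n with
  | zero => rw [modelS_zero, IsSecondOrder.bracket_C]; simp
  | succ n =>
    cases n' with
    | zero => rw [modelS_zero, derivation_C]; simp
    | succ n' =>
      rw [(isSecondOrder_modelGlue c).bracket_apply, modelS_succ, modelS_succ, modelGlue, secondOrderOp_X_mul_X,
        secondOrderOp_X, secondOrderOp_X]
      dsimp only
      rw [show n + 1 + (n' + 1) - 2 = n + n' by omega, add_comm n' n, add_comm e' e]
      push_cast
      linear_combination (-((n + 1) * (n' + 1)) * modelS c (n + n') (e + e' + 1)) *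
        C_half_mul_two (K := K)

theorem modelGlue_bracket_modelZ (x : ModelRing K) :
    (isSecondOrder_modelGlue c).bracket modelZ x = 0 := by
  have : (isSecondOrder_modelGlue c).bracket modelZ = 0 := by
    refine derivation_ext fun v => ?_
    rw [(isSecondOrder_modelGlue c).bracket_apply, modelZ, modelGlue, secondOrderOp_X_mul_X,
        secondOrderOp_X, secondOrderOp_X]
    rcases v with _ | ⟨n, e⟩ <;> simp
  rw [this]; rfl

/-- A relation `[G, d] = r G` between the gluing operator `G` and a derivation `d` may be checked on
the `s_{i,e}`, on `z`, and on the brackets of the `s_{i,e}`. -/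
theorem modelGlue_commutator (d : Derivation K (ModelRing K) (ModelRing K)) (r : K)
    (hs : ∀ n e, modelGlue c (d (modelS c n e)) - d (modelGlue c (modelS c n e)) =
      r • modelGlue c (modelS c n e))
    (hz : modelGlue c (d modelZ) = 0)
    (hdz : ∀ x, (isSecondOrder_modelGlue c).bracket (d modelZ) x = 0)
    (hss : ∀ n e n' e', (isSecondOrder_modelGlue c).bracket (d (modelS c n e)) (modelS c n' e') +
      (isSecondOrder_modelGlue c).bracket (modelS c n e) (d (modelS c n' e')) -
      d ((isSecondOrder_modelGlue c).bracket (modelS c n e) (modelS c n' e')) =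
      r • (isSecondOrder_modelGlue c).bracket (modelS c n e) (modelS c n' e')) :
    modelGlue c * d.toLinearMap - d.toLinearMap * modelGlue c = r • modelGlue c := by
  have hG := isSecondOrder_modelGlue c
  have hX : ∀ v : Option (ℕ × ℤ), modelGlue c (d (X v)) - d (modelGlue c (X v)) =
      r • modelGlue c (X v) := by
    rintro (_ | ⟨n, e⟩)
    · change modelGlue c (d modelZ) - d (modelGlue c modelZ) = r • modelGlue c modelZ
      rw [hz, modelGlue_modelZ, map_zero, smul_zero, sub_zero]
    · exact hs (n + 1) e
  have hXX : ∀ v w : Option (ℕ × ℤ), hG.bracket (d (X v)) (X w) + hG.bracket (X v) (d (X w)) -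
      d (hG.bracket (X v) (X w)) = r • hG.bracket (X v) (X w) := by
    rintro (_ | ⟨n, e⟩) w
    · change hG.bracket (d modelZ) (X w) + hG.bracket modelZ (d (X w)) -
        d (hG.bracket modelZ (X w)) = r • hG.bracket modelZ (X w)
      simp only [hdz, modelGlue_bracket_modelZ, map_zero, smul_zero, sub_zero, add_zero]
    · rcases w with _ | ⟨n', e'⟩
      · change hG.bracket (d (modelS c (n + 1) e)) modelZ + hG.bracket _ (d modelZ) -
          d (hG.bracket (modelS c (n + 1) e) modelZ) = r • hG.bracket (modelS c (n + 1) e) modelZ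
        simp only [hG.bracket_comm _ modelZ, hG.bracket_comm _ (d modelZ), hdz,
          modelGlue_bracket_modelZ, map_zero, smul_zero, sub_zero, add_zero]
      · exact hss (n + 1) e (n' + 1) e'
  refine (hG.commutator d).mvPolynomial_ext (hG.smul r) hX fun v w => ?_
  have e1 := hX v
  have e2 := hX w
  have e3 := hXX v w
  simp only [LinearMap.sub_apply, Module.End.mul_apply, LinearMap.smul_apply,
    Derivation.coeFn_coe, Derivation.leibniz, smul_eq_mul, map_add, hG.map_mul,
    smul_eq_C_mul] at *
  rw [hG.bracket_comm (X w) (d (X v))]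
  linear_combination e3 + X w * e1 + X v * e2

theorem modelGlue_bracket_zero_left (n : ℕ) (e e' : ℤ) :
    (isSecondOrder_modelGlue c).bracket (modelS c 0 e) (modelS c n e') = 0 := by
  rw [modelGlue_bracket_modelS]; simp

theorem modelGlue_bracket_zero_right (n : ℕ) (e e' : ℤ) :
    (isSecondOrder_modelGlue c).bracket (modelS c n e) (modelS c 0 e') = 0 := by
  rw [modelGlue_bracket_modelS]; simp

theorem commute_modelGlue_modelShift :
    Commute (modelGlue c) (modelShift c).toLinearMap := by
  refine sub_eq_zero.1 ((modelGlue_commutator c (modelShift c) 0 ?_ ?_ ?_ ?_).trans (zero_smul _ _))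
  · intro n e
    rw [modelShift_modelS, zero_smul, moduleEnd_natCast_mul, modelGlue_modelS,
      modelGlue_modelS]
    simp only [Derivation.leibniz, derivation_C, map_sub, Derivation.map_natCast,
      Derivation.map_one_eq_zero, modelShift_modelS, smul_eq_mul]
    rcases n with _ | _ | n
    · simp
    · simp
    · rw [show n + 1 + 1 - 1 - 2 = n + 1 + 1 - 2 - 1 by omega, Nat.add_sub_cancel,
        show n + 1 + 1 - 2 = n by omega]
      push_cast
      ring
  · rw [modelShift_modelZ, map_zero]
  · intro x
    rw [modelShift_modelZ, IsSecondOrder.bracket_zero_left]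
  · intro n e n' e'
    rw [zero_smul]
    rcases n with _ | n
    · rw [modelShift_modelS, modelShift_modelS, modelGlue_bracket_zero_left, derivation_natCast_mul,
        modelGlue_bracket_zero_left]
      simp [IsSecondOrder.bracket_zero_left]
    rcases n' with _ | n'
    · rw [modelShift_modelS, modelShift_modelS, modelGlue_bracket_zero_right,
        IsSecondOrder.bracket_natCast_mul, modelGlue_bracket_zero_right]
      simp
    rw [modelShift_modelS, modelShift_modelS, IsSecondOrder.bracket_natCast_mul,
      derivation_natCast_mul, modelGlue_bracket_modelS, modelGlue_bracket_modelS,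
      modelGlue_bracket_modelS]
    simp only [Derivation.leibniz, map_neg, Derivation.map_natCast, modelShift_modelS,
      smul_eq_mul, Nat.add_sub_cancel]
    rw [show n + (n' + 1) - 2 = n + n' - 1 by omega, show n + 1 + n' - 2 = n + n' - 1 by omega,
      show n + 1 + (n' + 1) - 2 = n + n' by omega]
    push_cast
    ring

theorem commute_modelGlue_modelDz :
    Commute (modelGlue c) (modelDz (K := K)).toLinearMap := by
  refine sub_eq_zero.1 ((modelGlue_commutator c modelDz 0 ?_ ?_ ?_ ?_).trans (zero_smul _ _))
  · intro n e
    rw [modelDz_modelS, modelGlue_modelS]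
    simp [Derivation.leibniz, modelDz_modelS]
  · rw [modelDz_modelZ, (isSecondOrder_modelGlue c).map_one]
  · intro x
    rw [modelDz_modelZ, (isSecondOrder_modelGlue c).bracket_comm, Derivation.map_one_eq_zero]
  · intro n e n' e'
    rw [modelDz_modelS, modelDz_modelS, modelGlue_bracket_modelS]
    simp [Derivation.leibniz, modelDz_modelS, IsSecondOrder.bracket_zero_left]

theorem modelGlue_mul_modelEuler :
    modelGlue c * modelEuler.toLinearMap - modelEuler.toLinearMap * modelGlue c =
      (2 : K) • modelGlue c := by
  refine modelGlue_commutator c modelEuler 2 ?_ ?_ ?_ ?_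
  · intro n e
    rw [modelEuler_modelS, moduleEnd_natCast_mul, modelGlue_modelS, smul_eq_C_mul]
    simp only [Derivation.leibniz, derivation_C, map_sub, Derivation.map_natCast,
      Derivation.map_one_eq_zero, modelEuler_modelS, smul_eq_mul, map_ofNat]
    rcases n with _ | _ | n
    · simp
    · simp
    · rw [show n + 1 + 1 - 2 = n by omega]
      push_cast
      ring
  · rw [modelEuler_modelZ, modelGlue_modelZ]
  · intro x
    rw [modelEuler_modelZ, modelGlue_bracket_modelZ]
  · intro n e n' e'
    rw [modelEuler_modelS, modelEuler_modelS, IsSecondOrder.bracket_natCast_mul,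
      derivation_natCast_mul, modelGlue_bracket_modelS, smul_eq_C_mul]
    simp only [Derivation.leibniz, map_neg, Derivation.map_natCast, modelEuler_modelS,
      smul_eq_mul, map_ofNat]
    rcases n with _ | n
    · simp
    rcases n' with _ | n'
    · simp
    rw [show n + 1 + (n' + 1) - 2 = n + n' by omega]
    push_cast
    ring

end Model

/-! ### Contractions in an orthogonal sum with a hyperbolic plane -/

/-- A second order operator `cap`, together with two directions `D`, `L` dual to linear coordinates
`u`, `v` that are constants for `cap`, and a quadratic element `y`. The situation modelled is a
quadratic space that is the orthogonal sum of a space of dimension `2 - 2 m`, with Laplacian `cap`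
and squared norm `-y`, and of a hyperbolic plane with coordinates `u`, `v`; the Laplacian of the sum
is `cap + D L`. Laplacians are normalised with a factor `1 / 2`. -/
structure HyperbolicSplitting (K B : Type*) [CommRing K] [CommRing B] [Algebra K B] (m : ℕ) where
  /-- The Laplacian of the first summand. -/
  cap : Module.End K B
  /-- The derivative in the direction of the coordinate `u`. -/
  D : Derivation K B B
  /-- The derivative in the direction of the coordinate `v`. -/
  L : Derivation K B B
  /-- The derivation counting degrees. -/
  euler : Derivation K B B
  /-- The first coordinate of the hyperbolic plane. -/
  u : B
  /-- The second coordinate of the hyperbolic plane. -/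
  v : B
  /-- The negative of the squared norm of the first summand. -/
  y : B
  /-- Evaluation at the origin. -/
  ε : B →ₐ[K] K
  ε_u : ε u = 0
  ε_v : ε v = 0
  ε_y : ε y = 0
  cap_D : ∀ x, cap (D x) = D (cap x)
  cap_L : ∀ x, cap (L x) = L (cap x)
  D_L : ∀ x, D (L x) = L (D x)
  D_u : D u = 1
  D_v : D v = 0
  D_y : D y = 0
  L_u : L u = 0
  L_v : L v = 1
  L_y : L y = 0
  cap_u : ∀ x, cap (u * x) = u * cap x
  cap_v : ∀ x, cap (v * x) = v * cap x
  cap_y : ∀ x, cap (y * x) = y * cap x + (2 * (m : K) - 2) • x -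
    2 * (euler x - u * D x - v * L x)
  euler_cap : ∀ x, euler (cap x) = cap (euler x) - 2 * cap x
  euler_L : ∀ x, euler (L x) = L (euler x) - L x
  euler_u : euler u = u
  euler_v : euler v = v
  euler_y : euler y = 2 * y

namespace HyperbolicSplitting

variable {K B : Type*} [CommRing K] [CommRing B] [Algebra K B] {m : ℕ}
  (h : HyperbolicSplitting K B m)

/-- The Laplacian of the orthogonal sum. -/
def full : Module.End K B := h.cap + h.D.toLinearMap * h.L.toLinearMap

theorem full_apply (x : B) : h.full x = h.cap x + h.D (h.L x) := rfl

theorem full_u (x : B) : h.full (h.u * x) = h.u * h.full x + h.L x := by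
  simp only [full_apply, h.cap_u, Derivation.leibniz, h.L_u, h.D_u, smul_eq_mul, mul_zero,
    add_zero, mul_one]
  ring

theorem full_L (x : B) : h.full (h.L x) = h.L (h.full x) := by
  simp only [full_apply, h.cap_L, map_add, h.D_L]

theorem full_pow_L (n : ℕ) (x : B) : (h.full ^ n) (h.L x) = h.L ((h.full ^ n) x) := by
  induction n with
  | zero => rfl
  | succ n ih => rw [pow_succ', Module.End.mul_apply, ih, full_L]; rfl

theorem full_pow_u (n : ℕ) (x : B) :
    (h.full ^ (n + 1)) (h.u * x) =
      h.u * (h.full ^ (n + 1)) x + (n + 1) * (h.full ^ n) (h.L x) := by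
  induction n with
  | zero => simp [full_u]
  | succ n ih =>
    have e : h.full ((h.full ^ n) (h.L x)) = (h.full ^ (n + 1)) (h.L x) := by
      rw [pow_succ']; rfl
    have := moduleEnd_natCast_mul h.full (n + 1) ((h.full ^ n) (h.L x))
    rw [pow_succ', Module.End.mul_apply, ih, map_add, full_u, ← full_pow_L, Module.End.mul_apply]
    push_cast at this ⊢
    rw [this, e]
    ring

/-- Wick's rule: under the total contraction, `u` is contracted with every other factor, which
amounts to differentiating in the direction `L`. -/
theorem contract_u_pow (n s : ℕ) (x : B) :
    h.ε ((h.full ^ n) (h.u ^ s * x)) =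
      n.descFactorial s * h.ε ((h.full ^ (n - s)) ((h.L.toLinearMap ^ s) x)) := by
  induction s generalizing n x with
  | zero => simp
  | succ s ih =>
    rcases n with _ | n
    · simp [h.ε_u, pow_succ]
    · have hL : h.L (h.u ^ s * x) = h.u ^ s * h.L x := by
        rw [Derivation.leibniz, Derivation.leibniz_pow, h.L_u]; simp
      rw [pow_succ' h.u, mul_assoc, full_pow_u, map_add, map_mul, h.ε_u, zero_mul, zero_add, hL,
        map_mul, ih, Nat.succ_descFactorial_succ, Nat.succ_sub_succ, pow_succ (h.L.toLinearMap),
        Module.End.mul_apply]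
      simp only [map_add, map_natCast, map_one, Derivation.coeFn_coe]
      push_cast
      ring

/-- On functions that do not depend on `u`, the hyperbolic plane does not contribute. -/
theorem full_pow_of_D_eq_zero (n : ℕ) {x : B} (hx : h.D x = 0) :
    (h.full ^ n) x = (h.cap ^ n) x := by
  induction n generalizing x with
  | zero => rfl
  | succ n ih =>
    rw [pow_succ, pow_succ, Module.End.mul_apply, Module.End.mul_apply, full_apply, h.D_L, hx,
      map_zero, add_zero, ih]
    rw [← h.cap_D, hx, map_zero]

theorem cap_pow_u (n : ℕ) (x : B) : (h.cap ^ n) (h.u * x) = h.u * (h.cap ^ n) x := by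
  induction n generalizing x with
  | zero => rfl
  | succ n ih => rw [pow_succ, Module.End.mul_apply, h.cap_u, ih, Module.End.mul_apply]

theorem cap_pow_v (n : ℕ) (x : B) : (h.cap ^ n) (h.v * x) = h.v * (h.cap ^ n) x := by
  induction n generalizing x with
  | zero => rfl
  | succ n ih => rw [pow_succ, Module.End.mul_apply, h.cap_v, ih, Module.End.mul_apply]

theorem L_pow_v (s : ℕ) (x : B) : (h.L.toLinearMap ^ (s + 1)) (h.v * x) =
    h.v * (h.L.toLinearMap ^ (s + 1)) x + (s + 1) * (h.L.toLinearMap ^ s) x := by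
  induction s with
  | zero => simp [Derivation.leibniz, h.L_v]
  | succ s ih =>
    have := derivation_natCast_mul h.L (s + 1) ((h.L.toLinearMap ^ s) x)
    have e : h.L ((h.L.toLinearMap ^ s) x) = (h.L.toLinearMap ^ (s + 1)) x := by
      rw [pow_succ']; rfl
    rw [pow_succ', Module.End.mul_apply, ih, Derivation.coeFn_coe, map_add, Derivation.leibniz,
      h.L_v]
    push_cast at this ⊢
    rw [this, e]
    simp only [Module.End.mul_apply, Derivation.coeFn_coe, smul_eq_mul]
    ring

/-- After differentiation in the direction `L`, only those terms survive in which every factor `v`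
has been differentiated. -/
theorem contract_L_pow_v_pow (n s b : ℕ) (x : B) :
    h.ε ((h.cap ^ n) ((h.L.toLinearMap ^ s) (h.v ^ b * x))) =
      s.descFactorial b * h.ε ((h.cap ^ n) ((h.L.toLinearMap ^ (s - b)) x)) := by
  induction b generalizing s with
  | zero => simp
  | succ b ih =>
    rcases s with _ | s
    · rw [pow_zero, Module.End.one_apply, pow_succ', mul_assoc, cap_pow_v, map_mul, h.ε_v]
      simp
    · have e := moduleEnd_natCast_mul (h.cap ^ n) (s + 1) ((h.L.toLinearMap ^ s) (h.v ^ b * x))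
      push_cast at e
      rw [pow_succ' h.v, mul_assoc, L_pow_v, map_add, e, cap_pow_v, map_add, map_mul, h.ε_v,
        zero_mul, zero_add, map_mul, ih, Nat.succ_descFactorial_succ, Nat.succ_sub_succ]
      simp only [map_add, map_natCast, map_one]
      push_cast
      ring

theorem L_pow_y_pow (s a : ℕ) (x : B) :
    (h.L.toLinearMap ^ s) (h.y ^ a * x) = h.y ^ a * (h.L.toLinearMap ^ s) x := by
  induction s with
  | zero => rfl
  | succ s ih =>
    rw [pow_succ', Module.End.mul_apply, ih, Derivation.coeFn_coe, Derivation.leibniz,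
      Derivation.leibniz_pow, h.L_y]
    simp

/-- The commutation relation of the Laplacian with the squared norm. -/
theorem cap_pow_y (i : ℕ) (x : B) : (h.cap ^ (i + 1)) (h.y * x) =
    h.y * (h.cap ^ (i + 1)) x + (i + 1) * (h.cap ^ i) ((2 * (m : K) - 2 + 2 * i) • x -
      2 * (h.euler x - h.u * h.D x - h.v * h.L x)) := by
  induction i generalizing x with
  | zero => simp [h.cap_y]; ring
  | succ i ih =>
    have e2 : ∀ z, (h.cap ^ (i + 1)) (2 * z) = 2 * (h.cap ^ (i + 1)) z := fun z => by
      exact_mod_cast moduleEnd_natCast_mul (h.cap ^ (i + 1)) 2 z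
    have e3 : ∀ z, (h.cap ^ i) (2 * z) = 2 * (h.cap ^ i) z := fun z => by
      exact_mod_cast moduleEnd_natCast_mul (h.cap ^ i) 2 z
    rw [pow_succ, Module.End.mul_apply, h.cap_y, map_sub, map_add, ih, h.euler_cap, ← h.cap_D,
      ← h.cap_L, ← h.cap_u, ← h.cap_v]
    simp only [map_sub, map_smul, e2, e3, ← Module.End.mul_apply, ← pow_succ]
    simp only [Algebra.smul_def, map_sub, map_add, map_mul, map_ofNat, map_natCast]
    push_cast
    ring

/-- Contracting a factor `y` multiplies by a scalar, which depends on the dimension `2 - 2 m` and on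
the degree `δ` of the cofactor. -/
theorem contract_y {i : ℕ} {δ : K} {x : B} (hx : h.euler x = δ • x) :
    h.ε ((h.cap ^ (i + 1)) (h.y * x)) =
      (i + 1) * (2 * (m : K) - 2 + 2 * i - 2 * δ) * h.ε ((h.cap ^ i) x) := by
  have e3 : ∀ z, (h.cap ^ i) (2 * z) = 2 * (h.cap ^ i) z := fun z => by
      exact_mod_cast moduleEnd_natCast_mul (h.cap ^ i) 2 z
  rw [cap_pow_y, hx]
  simp only [map_sub, map_add, map_mul, map_smul, e3, cap_pow_u, cap_pow_v, h.ε_u, h.ε_v, h.ε_y,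
    map_natCast, map_one, map_ofNat, smul_eq_mul]
  ring

theorem euler_y_pow_mul {δ : K} {x : B} (hx : h.euler x = δ • x) (a : ℕ) :
    h.euler (h.y ^ a * x) = (δ + 2 * a) • (h.y ^ a * x) := by
  induction a with
  | zero => simp [hx]
  | succ a ih =>
    rw [pow_succ', mul_assoc, Derivation.leibniz, ih, h.euler_y]
    simp only [smul_eq_mul]
    simp only [Algebra.smul_def, map_add, map_mul, map_natCast, map_ofNat]
    push_cast
    ring

theorem contract_y_pow_eq_zero {i a : ℕ} (hia : i < a) {δ : K} {x : B}
    (hx : h.euler x = δ • x) : h.ε ((h.cap ^ i) (h.y ^ a * x)) = 0 := by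
  induction i generalizing a with
  | zero =>
    obtain ⟨a, rfl⟩ := Nat.exists_eq_succ_of_ne_zero hia.ne'
    simp [pow_succ, h.ε_y]
  | succ i ih =>
    obtain ⟨a, rfl⟩ := Nat.exists_eq_succ_of_ne_zero (Nat.ne_zero_of_lt hia)
    rw [Nat.succ_eq_add_one, pow_succ' h.y, mul_assoc, h.contract_y (h.euler_y_pow_mul hx a),
      ih (by omega), mul_zero]

/-- For a cofactor of degree `2 M`, contracting the factors `y` gives an explicit scalar. -/
theorem contract_y_pow {M n a : ℕ} (hm : m = M + n + 1) (ha : a ≤ n + 1) {x : B}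
    (hx : h.euler x = (2 * (M : K)) • x) : h.ε ((h.cap ^ (M + a)) (h.y ^ a * x)) =
      2 ^ a * (M + a).descFactorial a * n.descFactorial a * h.ε ((h.cap ^ M) x) := by
  induction a with
  | zero => simp
  | succ a ih =>
    have e1 : (n.descFactorial (a + 1) : K) = ((n : K) - a) * n.descFactorial a := by
      rw [Nat.descFactorial_succ, Nat.cast_mul, Nat.cast_sub (by omega)]
    rw [pow_succ' h.y, mul_assoc, ← add_assoc, h.contract_y (h.euler_y_pow_mul hx a),
      ih (by omega), Nat.succ_descFactorial_succ, e1]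
    have hm' : (m : K) = M + n + 1 := by rw [hm]; push_cast; rfl
    push_cast
    rw [hm']
    ring

theorem euler_L_pow {δ : K} {x : B} (hx : h.euler x = δ • x) (s : ℕ) :
    h.euler ((h.L.toLinearMap ^ s) x) = (δ - s) • (h.L.toLinearMap ^ s) x := by
  induction s with
  | zero => simpa using hx
  | succ s ih =>
    rw [pow_succ', Module.End.mul_apply, Derivation.coeFn_coe, h.euler_L, ih,
      Derivation.map_smul]
    simp only [sub_smul, Nat.cast_add, Nat.cast_one, one_smul, add_smul]
    abel

/-- The alternating sum to which the contractions reduce. It vanishes because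
`∑ 2 ^ a (-1) ^ b (n choose a) = 1` and `∑ a 2 ^ a (-1) ^ b (n choose a) = 2 n`, where `a + b = n`. -/
theorem sum_choose_eq_zero (j : ℕ) :
    ∑ a ∈ Finset.range (j + 2), (2 : ℤ) ^ a * (-1) ^ (j + 1 - a) *
      (j + 1).choose a * ((j + 1 + (j + 1 - a) : ℕ) : ℤ) = 0 := by
  have h1 : ∑ a ∈ Finset.range (j + 2), (2 : ℤ) ^ a * (-1) ^ (j + 1 - a) * (j + 1).choose a =
      (2 + -1) ^ (j + 1) := (add_pow _ _ _).symm
  have h2 : ∑ a ∈ Finset.range (j + 2), (2 : ℤ) ^ a * (-1) ^ (j + 1 - a) *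
      (j + 1).choose a * a = 2 * (j + 1) * (2 + -1) ^ j := by
    rw [Finset.sum_range_succ', add_pow, Finset.mul_sum]
    simp only [CharP.cast_eq_zero, mul_zero, add_zero]
    refine Finset.sum_congr rfl fun a _ => ?_
    have : ((j : ℤ) + 1) * j.choose a = (j + 1).choose (a + 1) * (a + 1) := by
      exact_mod_cast Nat.add_one_mul_choose_eq j a
    rw [Nat.succ_sub_succ]
    push_cast
    linear_combination (-2 * 2 ^ a * (-1) ^ (j - a)) * this
  have h3 : ∀ a ∈ Finset.range (j + 2), (2 : ℤ) ^ a * (-1) ^ (j + 1 - a) *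
      (j + 1).choose a * ((j + 1 + (j + 1 - a) : ℕ) : ℤ) =
      2 * (j + 1) * (2 ^ a * (-1) ^ (j + 1 - a) * (j + 1).choose a) -
        2 ^ a * (-1) ^ (j + 1 - a) * (j + 1).choose a * a := by
    intro a ha
    have : a ≤ j + 1 := by rw [Finset.mem_range] at ha; omega
    push_cast [Nat.cast_sub this]
    ring
  rw [Finset.sum_congr rfl h3, Finset.sum_sub_distrib, ← Finset.mul_sum, h1, h2]
  norm_num

/-- The falling factorials produced by the factors `v` and `y` combine into a factor that does not
depend on the term, times `j + 1 + b`. -/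
theorem descFactorial_identity (j a b : ℕ) (hab : a + b = j + 1) :
    (j + 1 + b).descFactorial b * (2 * j + 1).descFactorial a =
      (j + 1 + b) * (2 * j + 1).descFactorial j := by
  have e1 := Nat.factorial_mul_descFactorial (show b ≤ j + 1 + b by omega)
  have e2 := Nat.factorial_mul_descFactorial (show a ≤ 2 * j + 1 by omega)
  have e3 := Nat.factorial_mul_descFactorial (show j ≤ 2 * j + 1 by omega)
  rw [show j + 1 + b - b = j + 1 by omega, show j + 1 + b = j + b + 1 by omega,
    Nat.factorial_succ (j + b)] at e1
  rw [show 2 * j + 1 - a = j + b by omega] at e2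
  rw [show 2 * j + 1 - j = j + 1 by omega] at e3
  refine Nat.eq_of_mul_eq_mul_left (mul_pos (Nat.factorial_pos (j + 1)) (Nat.factorial_pos (j + b))) ?_
  rw [show j + 1 + b = j + b + 1 by omega]
  calc _ = ((j + 1).factorial * (j + b + 1).descFactorial b) *
        ((j + b).factorial * (2 * j + 1).descFactorial a) := by ring
    _ = (j + b + 1) * (j + b).factorial *
        ((j + 1).factorial * (2 * j + 1).descFactorial j) := by rw [e1, e2, e3]
    _ = _ := by ring

/-- The total contraction of one term of the expansion of `(u y - u² v) ^ j w`. -/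
theorem contract_term (j a b : ℕ) {w : B} (hD : h.D w = 0) :
    h.ε ((h.full ^ m) (h.u ^ (j + b) * (h.v ^ b * (h.y ^ a * w)))) =
      m.descFactorial (j + b) * ((j + b).descFactorial b *
        h.ε ((h.cap ^ (m - (j + b))) (h.y ^ a * (h.L.toLinearMap ^ j) w))) := by
  have hv : h.D (h.v ^ b * (h.y ^ a * w)) = 0 := by
    simp [Derivation.leibniz, Derivation.leibniz_pow, h.D_v, h.D_y, hD]
  have hDL : ∀ s x, h.D x = 0 → h.D ((h.L.toLinearMap ^ s) x) = 0 := by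
    intro s x hx
    induction s with
    | zero => exact hx
    | succ s ih =>
      rw [pow_succ', Module.End.mul_apply, Derivation.coeFn_coe, h.D_L, ih, map_zero]
  rw [h.contract_u_pow, h.full_pow_of_D_eq_zero _ (hDL _ _ hv), h.contract_L_pow_v_pow,
    Nat.add_sub_cancel, L_pow_y_pow]

/-- In dimension `2 - 2 m`, the total contractions of the terms of `(u y - u² v) ^ j w` cancel. -/
theorem contract_mixed (j : ℕ) {w : B} (hD : h.D w = 0)
    (hw : h.euler w = (2 * (m : K) - 3 * ((j + 1 : ℕ) : K)) • w) :
    h.ε ((h.full ^ m) ((h.u * h.y + -(h.u ^ 2 * h.v)) ^ (j + 1) * w)) = 0 := by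
  have hLw := h.euler_L_pow hw (j + 1)
  have hsum : (h.u * h.y + -(h.u ^ 2 * h.v)) ^ (j + 1) * w =
      ∑ a ∈ Finset.range (j + 2), ((-1) ^ (j + 1 - a) * ((j + 1).choose a : K)) •
        (h.u ^ (j + 1 + (j + 1 - a)) * (h.v ^ (j + 1 - a) * (h.y ^ a * w))) := by
    rw [add_pow, Finset.sum_mul]
    refine Finset.sum_congr rfl fun a ha => ?_
    obtain ⟨b, hb⟩ : ∃ b, j + 1 = a + b := by
      rw [Finset.mem_range] at ha; exact ⟨j + 1 - a, by omega⟩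
    rw [hb, Nat.add_sub_cancel_left, Algebra.smul_def, neg_pow (h.u ^ 2 * h.v)]
    simp only [map_mul, map_pow, map_neg, map_one, map_natCast]
    ring
  rw [hsum, map_sum, map_sum]
  simp only [map_smul, smul_eq_mul]
  rcases Nat.lt_or_ge m (2 * (j + 1)) with hm | hm
  · -- Here the cofactor of the powers of `y` has negative degree, and every term vanishes.
    refine Finset.sum_eq_zero fun a ha => ?_
    have ha' : a + (j + 1 - a) = j + 1 := by rw [Finset.mem_range] at ha; omega
    rw [h.contract_term (j + 1) a _ hD]
    rcases Nat.lt_or_ge m (j + 1 + (j + 1 - a)) with h1 | h1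
    · rw [Nat.descFactorial_of_lt h1]; simp
    · rw [h.contract_y_pow_eq_zero (by omega) hLw]; simp
  · obtain ⟨M, hM⟩ := Nat.exists_eq_add_of_le' hm
    have hLw' : h.euler ((h.L.toLinearMap ^ (j + 1)) w) =
        (2 * (M : K)) • (h.L.toLinearMap ^ (j + 1)) w := by
      have hM' : (m : K) = M + 2 * (j + 1) := by
        conv_lhs => rw [hM]
        push_cast; rfl
      rw [hLw, hM']; congr 1; push_cast; ring
    -- Each term is a coefficient of the alternating sum times a factor that is independent of `a`.
    have hterm : ∀ a ∈ Finset.range (j + 2), (-1) ^ (j + 1 - a) * ((j + 1).choose a : K) *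
        h.ε ((h.full ^ m) (h.u ^ (j + 1 + (j + 1 - a)) *
          (h.v ^ (j + 1 - a) * (h.y ^ a * w)))) =
        ((2 ^ a * (-1) ^ (j + 1 - a) * (j + 1).choose a * ((j + 1 + (j + 1 - a) : ℕ) : ℤ) : ℤ) : K) *
          (m.descFactorial (2 * (j + 1)) * (2 * j + 1).descFactorial j *
            h.ε ((h.cap ^ M) ((h.L.toLinearMap ^ (j + 1)) w))) := by
      intro a ha
      obtain ⟨b, hb⟩ : ∃ b, j + 1 - a = b := ⟨_, rfl⟩
      have hab : a + b = j + 1 := by rw [Finset.mem_range] at ha; omega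
      rw [hb, h.contract_term (j + 1) a b hD, show m - (j + 1 + b) = M + a by omega,
        h.contract_y_pow (n := 2 * j + 1) (by omega) (by omega) hLw']
      have e1 : ((m.descFactorial (j + 1 + b) * (M + a).descFactorial a : ℕ) : K) =
          m.descFactorial (2 * (j + 1)) := by
        rw [mul_comm, ← Nat.descFactorial_mul_descFactorial (n := m)
          (show j + 1 + b ≤ 2 * (j + 1) by omega)]
        rw [show m - (j + 1 + b) = M + a by omega, show 2 * (j + 1) - (j + 1 + b) = a by omega]
      have e2 := congrArg (Nat.cast : ℕ → K) (descFactorial_identity j a b hab)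
      push_cast at e1 e2 ⊢
      rw [← e1]
      linear_combination (-1) ^ b * ((j + 1).choose a : K) * m.descFactorial (j + 1 + b) * 2 ^ a *
        (M + a).descFactorial a * h.ε ((h.cap ^ M) ((h.L.toLinearMap ^ (j + 1)) w)) * e2
    rw [Finset.sum_congr rfl hterm, ← Finset.sum_mul, ← Int.cast_sum, sum_choose_eq_zero]
    simp

/-- The total contractions of `(w + 3 (u y - u² v)) ^ N` in the orthogonal sum and of `g ^ N` in
the first summand agree when `g` is the restriction of `w` to the first summand. -/
theorem contract_cubic {N : ℕ} (hN : 3 * N = 2 * m) {w g p p' : B} (hD : h.D w = 0)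
    (hw : h.euler w = 3 * w) (hg : w = g + h.u * p + h.v * p') :
    h.ε ((h.full ^ m) ((w + 3 * (h.u * h.y - h.u ^ 2 * h.v)) ^ N)) =
      h.ε ((h.cap ^ m) (g ^ N)) := by
  have hpow : ∀ n : ℕ, h.euler (w ^ n) = (3 * (n : K)) • w ^ n := by
    intro n
    rw [Derivation.leibniz_pow, hw]
    rcases n with _ | n
    · simp
    · simp only [smul_eq_mul, nsmul_eq_mul, Nat.add_sub_cancel, pow_succ]
      simp only [Algebra.smul_def, map_mul, map_ofNat, map_natCast]
      ring
  have hDpow : ∀ n : ℕ, h.D (w ^ n) = 0 := by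
    intro n
    rw [Derivation.leibniz_pow, hD]; simp
  have hsplit : (w + 3 * (h.u * h.y - h.u ^ 2 * h.v)) ^ N = ∑ j ∈ Finset.range (N + 1),
      (3 ^ j * (N.choose j : K)) • ((h.u * h.y + -(h.u ^ 2 * h.v)) ^ j * w ^ (N - j)) := by
    rw [add_comm, add_pow]
    refine Finset.sum_congr rfl fun j _ => ?_
    simp only [Algebra.smul_def, map_mul, map_pow, map_ofNat, map_natCast, mul_pow,
      ← sub_eq_add_neg]
    ring
  rw [hsplit, map_sum, map_sum, Finset.sum_range_succ', Finset.sum_eq_zero, zero_add]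
  · simp only [pow_zero, Nat.choose_zero_right, Nat.cast_one, mul_one, one_smul, one_mul,
      Nat.sub_zero]
    -- Only `w ^ N` survives, and it agrees with `g ^ N` up to multiples of `u` and `v`.
    rw [h.full_pow_of_D_eq_zero m (hDpow N)]
    obtain ⟨r, hr⟩ := sub_dvd_pow_sub_pow w g N
    have : w ^ N = g ^ N + (h.u * (p * r) + h.v * (p' * r)) := by
      rw [← sub_eq_iff_eq_add', hr, hg]; ring
    rw [this, map_add, map_add, map_add, map_add, cap_pow_u, cap_pow_v,
      map_mul h.ε, map_mul h.ε, h.ε_u, h.ε_v]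
    simp
  · intro j hj
    rw [map_smul, map_smul, h.contract_mixed j (hDpow _), smul_zero]
    rw [hpow]
    congr 1
    have : j + 1 ≤ N := by rw [Finset.mem_range] at hj; omega
    rw [Nat.cast_sub this]
    have : (3 * N : K) = 2 * m := by exact_mod_cast congrArg (Nat.cast : ℕ → K) hN
    linear_combination this

end HyperbolicSplitting

/-! ### The model ring as an orthogonal sum -/

section CappedModel

variable {K : Type*} [CommRing K] [Algebra ℚ K] (c : ℤ → K) (φ : Kˣ)

/-- The operator `∂_1 - ∂_2 + ∂_ψ + ∂'_ψ` in the variables `s_{i,e}`. -/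
noncomputable def modelCap : Module.End K (ModelRing K) :=
  modelGlue c + (half K * φ) • ((modelShift c).toLinearMap * (modelShift c).toLinearMap)

theorem isSecondOrder_modelCap : IsSecondOrder (modelCap c φ) :=
  (isSecondOrder_modelGlue c).add ((IsSecondOrder.derivation_mul _ _).smul _)

theorem modelCap_apply (x : ModelRing K) : modelCap c φ x =
    modelGlue c x + C (half K * φ) * modelShift c (modelShift c x) := by
  rw [← smul_eq_C_mul]; rfl

theorem modelCap_bracket (x y : ModelRing K) : (isSecondOrder_modelCap c φ).bracket x y =
    (isSecondOrder_modelGlue c).bracket x y + C (φ : K) * modelShift c x * modelShift c y := by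
  rw [IsSecondOrder.bracket_apply, IsSecondOrder.bracket_apply, modelCap_apply, modelCap_apply,
    modelCap_apply]
  simp only [Derivation.leibniz, map_add, smul_eq_mul, C_mul]
  linear_combination C (φ : K) * modelShift c x * modelShift c y * C_half_mul_two (K := K)

theorem modelCap_modelS (n : ℕ) (e : ℤ) : modelCap c φ (modelS c n e) =
    C (half K) * ((n : ModelRing K) * ((n : ModelRing K) - 1)) *
      (modelS c (n - 2) (e + 1) + C (φ : K) * modelS c (n - 2) e) := by
  rw [modelCap_apply, modelGlue_modelS, modelShift_modelS, derivation_natCast_mul,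
    modelShift_modelS, C_mul]
  rcases n with _ | _ | n
  · simp
  · simp
  · rw [show n + 1 + 1 - 1 - 1 = n + 1 + 1 - 2 by omega, Nat.add_sub_cancel]
    push_cast
    ring

theorem modelCap_bracket_modelS (n n' : ℕ) (e e' : ℤ) :
    (isSecondOrder_modelCap c φ).bracket (modelS c n e) (modelS c n' e') =
      (n * n' : ModelRing K) * (C (φ : K) * modelS c (n - 1) e * modelS c (n' - 1) e' -
        modelS c (n + n' - 2) (e + e' + 1)) := by
  rw [modelCap_bracket, modelGlue_bracket_modelS, modelShift_modelS, modelShift_modelS]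
  ring

theorem modelCap_bracket_modelZ (x : ModelRing K) :
    (isSecondOrder_modelCap c φ).bracket modelZ x = 0 := by
  rw [modelCap_bracket, modelGlue_bracket_modelZ, modelShift_modelZ]; ring

theorem modelCap_modelZ : modelCap c φ modelZ = 0 := by
  rw [modelCap_apply, modelGlue_modelZ, modelShift_modelZ, map_zero]; simp

omit [Algebra ℚ K] in
theorem modelShift_modelDz (x : ModelRing K) :
    modelShift c (modelDz x) = modelDz (modelShift c x) := by
  have : ⁅modelShift c, (modelDz : Derivation K (ModelRing K) (ModelRing K))⁆ = 0 := by
    refine modelRing_derivation_ext c (fun n e => ?_) ?_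
    · rw [Derivation.commutator_apply, modelDz_modelS, modelShift_modelS, derivation_natCast_mul,
        modelDz_modelS]
      simp
    · rw [Derivation.commutator_apply, modelDz_modelZ, modelShift_modelZ]
      simp
  have := congrArg (fun d => d x) this
  simp only [Derivation.commutator_apply, Derivation.zero_apply] at this
  exact sub_eq_zero.1 this

omit [Algebra ℚ K] in
theorem modelEuler_modelShift (x : ModelRing K) :
    modelEuler (modelShift c x) = modelShift c (modelEuler x) - modelShift c x := by
  have : ⁅(modelEuler : Derivation K (ModelRing K) (ModelRing K)), modelShift c⁆ = -modelShift c := by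
    refine modelRing_derivation_ext c (fun n e => ?_) ?_
    · rw [Derivation.commutator_apply, Derivation.neg_apply, modelEuler_modelS, modelShift_modelS,
        derivation_natCast_mul, derivation_natCast_mul, modelEuler_modelS, modelShift_modelS]
      rcases n with _ | n
      · simp
      · rw [Nat.add_sub_cancel]; push_cast; ring
    · rw [Derivation.commutator_apply, Derivation.neg_apply, modelEuler_modelZ, modelShift_modelZ]
      simp
  have := congrArg (fun d => d x) this
  simp only [Derivation.commutator_apply, Derivation.neg_apply] at this
  linear_combination this

omit [Algebra ℚ K] in
theorem modelEuler_modelDz (x : ModelRing K) :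
    modelEuler (modelDz x) = modelDz (modelEuler x) - modelDz x := by
  have : ⁅(modelEuler : Derivation K (ModelRing K) (ModelRing K)), modelDz⁆ =
      -(modelDz : Derivation K (ModelRing K) (ModelRing K)) := by
    refine modelRing_derivation_ext 0 (fun n e => ?_) ?_
    · rw [Derivation.commutator_apply, Derivation.neg_apply, modelEuler_modelS, modelDz_modelS,
        derivation_natCast_mul, modelDz_modelS]
      simp
    · rw [Derivation.commutator_apply, Derivation.neg_apply, modelEuler_modelZ, modelDz_modelZ]
      simp
  have := congrArg (fun d => d x) this
  simp only [Derivation.commutator_apply, Derivation.neg_apply] at this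
  linear_combination this

theorem modelCap_modelShift (x : ModelRing K) :
    modelCap c φ (modelShift c x) = modelShift c (modelCap c φ x) := by
  have := congrArg (fun f => f x) (commute_modelGlue_modelShift c).eq
  simp only [Module.End.mul_apply, Derivation.coeFn_coe] at this
  simp only [modelCap_apply, this, map_add, ← smul_eq_C_mul, Derivation.map_smul]

theorem modelCap_modelDz (x : ModelRing K) :
    modelCap c φ (modelDz x) = modelDz (modelCap c φ x) := by
  have := congrArg (fun f => f x) (commute_modelGlue_modelDz c).eq
  simp only [Module.End.mul_apply, Derivation.coeFn_coe] at this
  simp only [modelCap_apply, this, map_add, ← smul_eq_C_mul, Derivation.map_smul,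
    modelShift_modelDz]

theorem modelEuler_modelCap (x : ModelRing K) :
    modelEuler (modelCap c φ x) = modelCap c φ (modelEuler x) - 2 * modelCap c φ x := by
  have := congrArg (fun f => f x) (modelGlue_mul_modelEuler c)
  simp only [Module.End.mul_apply, Derivation.coeFn_coe, LinearMap.sub_apply,
    LinearMap.smul_apply, smul_eq_C_mul, map_ofNat] at this
  simp only [modelCap_apply, map_add, Derivation.leibniz, modelEuler_modelShift, map_sub,
    derivation_C, smul_eq_mul]
  linear_combination -this

/-- The inner product with the isotropic vector, a coordinate of the hyperbolic plane. -/
noncomputable def modelV : ModelRing K := C ((φ⁻¹ : Kˣ) : K) * modelZ - modelS c 1 (-1)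

/-- The coordinate of the hyperbolic plane along the isotropic vector. -/
noncomputable def modelU : ModelRing K := C (half K) * (modelZ + C (φ : K) * modelS c 1 (-1))

/-- The quadratic element on which the bracket of the capped operator counts degrees. -/
noncomputable def modelY : ModelRing K := modelS c 2 (-1) - C (φ : K) * modelS c 1 (-1) ^ 2

/-- The shift of all coordinates along the isotropic vector. -/
noncomputable def modelD : Derivation K (ModelRing K) (ModelRing K) := modelShift c + modelDz

/-- The derivative in the direction complementary to the isotropic vector. -/
noncomputable def modelL : Derivation K (ModelRing K) (ModelRing K) :=
  (half K * φ) • (modelDz - modelShift c)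

omit [Algebra ℚ K] in
theorem modelD_apply (x : ModelRing K) : modelD c x = modelShift c x + modelDz x := rfl

theorem modelL_apply (x : ModelRing K) :
    modelL c φ x = C (half K) * C (φ : K) * (modelDz x - modelShift c x) := by
  rw [← C_mul, ← smul_eq_C_mul]; rfl

variable {c φ}

omit [Algebra ℚ K] in
theorem C_unit_mul_inv : (C (φ : K) : ModelRing K) * C ((φ⁻¹ : Kˣ) : K) = 1 := by
  rw [← C_mul, φ.mul_inv, C_1]

/-- Since `c (-1) φ = 1`, the gluing and the capping brackets with `s_{1,-1}` cancel: this element is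
constant for the capped operator. -/
theorem modelCap_bracket_modelS_one (hc : c (-1) = ((φ⁻¹ : Kˣ) : K)) (x : ModelRing K) :
    (isSecondOrder_modelCap c φ).bracket (modelS c 1 (-1)) x = 0 := by
  have : (isSecondOrder_modelCap c φ).bracket (modelS c 1 (-1)) = 0 := by
    refine modelRing_derivation_ext c (fun n e => ?_) ?_
    · rw [modelCap_bracket_modelS, Nat.sub_self, modelS_zero, hc, C_unit_mul_inv,
        show 1 + n - 2 = n - 1 by omega, show -1 + e + 1 = e by ring]
      simp
    · rw [IsSecondOrder.bracket_comm, modelCap_bracket_modelZ]; rfl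
  rw [this]; rfl

theorem modelCap_modelS_one (e : ℤ) : modelCap c φ (modelS c 1 e) = 0 := by
  rw [modelCap_modelS]; simp

theorem modelCap_modelV_mul (hc : c (-1) = ((φ⁻¹ : Kˣ) : K)) (x : ModelRing K) :
    modelCap c φ (modelV c φ * x) = modelV c φ * modelCap c φ x := by
  have h1 := (isSecondOrder_modelCap c φ).map_mul modelZ x
  have h2 := (isSecondOrder_modelCap c φ).map_mul (modelS c 1 (-1)) x
  rw [modelCap_bracket_modelZ, modelCap_modelZ] at h1
  rw [modelCap_bracket_modelS_one hc, modelCap_modelS_one] at h2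
  rw [modelV, sub_mul, map_sub, mul_assoc, modelRing_map_C_mul, h1, h2]
  ring

theorem modelCap_modelU_mul (hc : c (-1) = ((φ⁻¹ : Kˣ) : K)) (x : ModelRing K) :
    modelCap c φ (modelU c φ * x) = modelU c φ * modelCap c φ x := by
  have h1 := (isSecondOrder_modelCap c φ).map_mul modelZ x
  have h2 := (isSecondOrder_modelCap c φ).map_mul (modelS c 1 (-1)) x
  rw [modelCap_bracket_modelZ, modelCap_modelZ] at h1
  rw [modelCap_bracket_modelS_one hc, modelCap_modelS_one] at h2
  rw [modelU, mul_assoc, modelRing_map_C_mul, add_mul, map_add, mul_assoc,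
    modelRing_map_C_mul, h1, h2]
  ring

theorem modelCap_modelY {m : ℕ} (hc : c (-1) = ((φ⁻¹ : Kˣ) : K)) (hc0 : c 0 = 2 * (m : K) - 3) :
    modelCap c φ (modelY c φ) = 2 * (m : ModelRing K) - 2 := by
  rw [modelY, map_sub, modelRing_map_C_mul, pow_two,
    (isSecondOrder_modelCap c φ).map_mul, modelCap_bracket_modelS_one hc, modelCap_modelS_one,
    modelCap_modelS, Nat.sub_self, modelS_zero, modelS_zero, hc, C_unit_mul_inv,
    show (-1 : ℤ) + 1 = 0 by ring, hc0]
  simp only [map_sub, map_mul, map_ofNat, map_natCast]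
  push_cast
  linear_combination (2 * (m : ModelRing K) - 2) * C_half_mul_two (K := K)

theorem modelCap_bracket_modelY (hc : c (-1) = ((φ⁻¹ : Kˣ) : K)) (x : ModelRing K) :
    (isSecondOrder_modelCap c φ).bracket (modelY c φ) x =
      -2 * (modelEuler x - modelU c φ * modelD c x - modelV c φ * modelL c φ x) := by
  have : (isSecondOrder_modelCap c φ).bracket (modelY c φ) =
      (-2 : ModelRing K) • (modelEuler - modelU c φ • modelD c - modelV c φ • modelL c φ) := by
    refine modelRing_derivation_ext c (fun n e => ?_) ?_
    · rw [IsSecondOrder.bracket_comm]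
      simp only [Derivation.smul_apply, Derivation.sub_apply, smul_eq_mul, modelD_apply,
        modelL_apply, modelEuler_modelS, modelDz_modelS, modelShift_modelS]
      rw [modelY, map_sub, Derivation.leibniz, derivation_C, Derivation.leibniz_pow,
        IsSecondOrder.bracket_comm _ _ (modelS c 1 (-1)), modelCap_bracket_modelS_one hc,
        modelCap_bracket_modelS, Nat.add_sub_cancel, show e + -1 + 1 = e by ring]
      simp only [smul_zero, modelU, modelV]
      push_cast
      linear_combination (n * modelS c (n - 1) e * C (half K) * 2 * modelZ) *
          C_unit_mul_inv (φ := φ) -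
        (2 * n * modelS c (n - 1) e * C (φ : K) * modelS c 1 (-1)) * C_half_mul_two (K := K)
    · rw [IsSecondOrder.bracket_comm, modelCap_bracket_modelZ]
      simp only [Derivation.smul_apply, Derivation.sub_apply, smul_eq_mul, modelD_apply,
        modelL_apply, modelEuler_modelZ, modelDz_modelZ, modelShift_modelZ, modelU, modelV]
      linear_combination (-2 * C (half K) * modelZ) * C_unit_mul_inv (φ := φ) -
        2 * modelZ * C_half_mul_two (K := K)
  rw [this]
  rfl

/-- The model ring as an orthogonal sum: the scalar `c 0` encodes the dimension, and
`c (-1) = φ⁻¹` makes the shift vector isotropic. -/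
noncomputable def modelSplitting {m : ℕ} (hc : c (-1) = ((φ⁻¹ : Kˣ) : K))
    (hc0 : c 0 = 2 * (m : K) - 3) : HyperbolicSplitting K (ModelRing K) m where
  cap := modelCap c φ
  D := modelD c
  L := modelL c φ
  euler := modelEuler
  u := modelU c φ
  v := modelV c φ
  y := modelY c φ
  ε := aeval 0
  ε_u := by simp [modelU, modelZ, modelS]
  ε_v := by simp [modelV, modelZ, modelS]
  ε_y := by simp [modelY, modelS]
  cap_D x := by simp only [modelD_apply, map_add, modelCap_modelShift, modelCap_modelDz]
  cap_L x := by
    simp only [modelL_apply, mul_assoc, modelRing_map_C_mul, map_sub, modelCap_modelShift,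
      modelCap_modelDz]
  D_L x := by
    simp only [modelL_apply, modelD_apply, Derivation.leibniz, derivation_C, map_sub, map_add,
      modelShift_modelDz, smul_eq_mul]
    ring
  D_u := by
    simp only [modelD_apply, modelU, Derivation.leibniz, derivation_C, map_add, modelShift_modelS,
      modelShift_modelZ, modelDz_modelS, modelDz_modelZ, Nat.sub_self, modelS_zero, hc, smul_eq_mul]
    push_cast
    linear_combination C (half K) * C_unit_mul_inv (φ := φ) + C_half_mul_two (K := K)
  D_v := by
    simp only [modelD_apply, modelV, Derivation.leibniz, derivation_C, map_sub, modelShift_modelS,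
      modelShift_modelZ, modelDz_modelS, modelDz_modelZ, Nat.sub_self, modelS_zero, hc, smul_eq_mul]
    push_cast
    ring
  D_y := by
    simp only [modelD_apply, modelY, Derivation.leibniz, Derivation.leibniz_pow, derivation_C,
      map_sub, modelShift_modelS, modelDz_modelS, Nat.sub_self, modelS_zero, hc, smul_eq_mul,
      show 2 - 1 = 1 from rfl]
    push_cast
    linear_combination -2 * modelS c 1 (-1) * C_unit_mul_inv (φ := φ)
  L_u := by
    simp only [modelL_apply, modelU, Derivation.leibniz, derivation_C, map_add, modelShift_modelS,
      modelShift_modelZ, modelDz_modelS, modelDz_modelZ, Nat.sub_self, modelS_zero, hc, smul_eq_mul]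
    push_cast
    linear_combination -C (half K) * C (φ : K) * C (half K) * C_unit_mul_inv (φ := φ)
  L_v := by
    simp only [modelL_apply, modelV, Derivation.leibniz, derivation_C, map_sub, modelShift_modelS,
      modelShift_modelZ, modelDz_modelS, modelDz_modelZ, Nat.sub_self, modelS_zero, hc, smul_eq_mul]
    push_cast
    linear_combination 2 * C (half K) * C_unit_mul_inv (φ := φ) + C_half_mul_two (K := K)
  L_y := by
    simp only [modelL_apply, modelY, Derivation.leibniz, Derivation.leibniz_pow, derivation_C,
      map_sub, modelShift_modelS, modelDz_modelS, Nat.sub_self, modelS_zero, hc, smul_eq_mul,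
      show 2 - 1 = 1 from rfl]
    push_cast
    linear_combination 2 * modelS c 1 (-1) * C (half K) * C (φ : K) * C_unit_mul_inv (φ := φ)
  cap_u := modelCap_modelU_mul hc
  cap_v := modelCap_modelV_mul hc
  cap_y x := by
    rw [(isSecondOrder_modelCap c φ).map_mul, modelCap_modelY hc hc0, modelCap_bracket_modelY hc,
      smul_eq_C_mul]
    simp only [map_sub, map_mul, map_ofNat, map_natCast]
    ring
  euler_cap := modelEuler_modelCap c φ
  euler_L x := by
    simp only [modelL_apply, Derivation.leibniz, derivation_C, map_sub, modelEuler_modelShift,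
      modelEuler_modelDz, smul_eq_mul]
    ring
  euler_u := by
    simp only [modelU, Derivation.leibniz, derivation_C, map_add, modelEuler_modelS,
      modelEuler_modelZ, smul_eq_mul]
    push_cast
    ring
  euler_v := by
    simp only [modelV, Derivation.leibniz, derivation_C, map_sub, modelEuler_modelS,
      modelEuler_modelZ, smul_eq_mul]
    push_cast
    ring
  euler_y := by
    simp only [modelY, Derivation.leibniz, Derivation.leibniz_pow, derivation_C, map_sub,
      modelEuler_modelS, smul_eq_mul]
    push_cast
    ring

/-- The Laplacian of the sum is the gluing operator plus `φ / 2` times the second derivative in the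
additional coordinate `z`: adding the hyperbolic plane removes the capping. -/
theorem modelSplitting_full_apply {m : ℕ} (hc : c (-1) = ((φ⁻¹ : Kˣ) : K))
    (hc0 : c 0 = 2 * (m : K) - 3) (x : ModelRing K) :
    (modelSplitting hc hc0).full x =
      modelGlue c x + C (half K) * C (φ : K) * modelDz (modelDz x) := by
  change modelCap c φ x + modelD c (modelL c φ x) = _
  simp only [modelL_apply, modelD_apply, modelCap_apply, Derivation.leibniz, derivation_C, map_sub,
    smul_eq_mul, modelShift_modelDz, C_mul]
  ring

/-- The two total contractions of the powers of the cubic elements agree. -/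
theorem modelSplitting_contract {m N : ℕ} (hN : 3 * N = 2 * m) (hc : c (-1) = ((φ⁻¹ : Kˣ) : K))
    (hc0 : c 0 = 2 * (m : K) - 3) :
    (aeval 0 : ModelRing K →ₐ[K] K) (((modelSplitting hc hc0).full ^ m)
      ((modelS c 3 (-1) - C ((φ⁻¹ : Kˣ) : K) * modelZ ^ 3) ^ N)) =
    (aeval 0 : ModelRing K →ₐ[K] K) ((modelCap c φ ^ m) (modelS c 3 (-1) ^ N)) := by
  set h := modelSplitting hc hc0 with hh
  set f : ModelRing K := modelS c 3 (-1) - C ((φ⁻¹ : Kˣ) : K) * modelZ ^ 3 with hf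
  have hz : modelZ = h.u + C (half K) * C (φ : K) * h.v := by
    change _ = modelU c φ + C (half K) * C (φ : K) * modelV c φ
    rw [modelU, modelV]
    linear_combination -C (half K) * modelZ * C_unit_mul_inv (φ := φ) -
      modelZ * C_half_mul_two (K := K)
  have key := h.contract_cubic hN (w := f - 3 * (h.u * h.y - h.u ^ 2 * h.v)) (g := modelS c 3 (-1))
    (p := -(C ((φ⁻¹ : Kˣ) : K) * modelZ ^ 2) - 3 * h.y + 3 * (h.u * h.v))
    (p' := -(C (half K) * modelZ ^ 2)) ?_ ?_ ?_
  · rw [sub_add_cancel] at key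
    exact key
  -- The remainder is annihilated by `D`, because `D f = 3 (y - 2 u v)`.
  · have e1 : h.D f = 3 * modelS c 2 (-1) - 3 * C ((φ⁻¹ : Kˣ) : K) * modelZ ^ 2 := by
      change modelD c f = _
      rw [modelD_apply, hf]
      simp only [Derivation.leibniz, Derivation.leibniz_pow, derivation_C, map_sub,
        modelShift_modelS, modelShift_modelZ, modelDz_modelS, modelDz_modelZ, smul_eq_mul,
        show 3 - 1 = 2 from rfl]
      push_cast
      ring
    have e2 : h.y - 2 * (h.u * h.v) = modelS c 2 (-1) - C ((φ⁻¹ : Kˣ) : K) * modelZ ^ 2 := by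
      change modelY c φ - 2 * (modelU c φ * modelV c φ) = _
      rw [modelY, modelU, modelV]
      linear_combination (C (φ : K) * modelS c 1 (-1) ^ 2 -
        C ((φ⁻¹ : Kˣ) : K) * modelZ ^ 2) * C_half_mul_two (K := K) -
        2 * C (half K) * modelS c 1 (-1) * modelZ * C_unit_mul_inv (φ := φ)
    simp only [Derivation.leibniz, Derivation.leibniz_pow, map_sub, e1, h.D_u, h.D_v, h.D_y,
      smul_eq_mul, show (3 : ModelRing K) = ((3 : ℕ) : ModelRing K) by norm_num,
      Derivation.map_natCast]
    push_cast
    linear_combination -3 * e2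
  · have e1 : h.euler f = 3 * f := by
      change modelEuler f = _
      rw [hf]
      simp only [Derivation.leibniz, Derivation.leibniz_pow, derivation_C, map_sub,
        modelEuler_modelS, modelEuler_modelZ, smul_eq_mul]
      push_cast
      ring
    rw [map_sub, show (3 : ModelRing K) * (h.u * h.y - h.u ^ 2 * h.v) =
      ((3 : ℕ) : ModelRing K) * (h.u * h.y - h.u ^ 2 * h.v) by norm_num, derivation_natCast_mul, e1]
    simp only [Derivation.leibniz, Derivation.leibniz_pow, map_sub, h.euler_u, h.euler_v, h.euler_y,
      smul_eq_mul]
    push_cast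
    ring
  · rw [hf]
    linear_combination (-C ((φ⁻¹ : Kˣ) : K) * modelZ ^ 2) * hz -
      C (half K) * h.v * modelZ ^ 2 * C_unit_mul_inv (φ := φ)

end CappedModel

/-! ### Comparison with the rings of generators -/

section Evaluation

/-- The generator `q_{i,j}` with `i = n` and `j = n + 2 e`. -/
noncomputable def qGen (S : Set (ℤ × ℤ)) (n : ℕ) (e : ℤ) : QRing S := q S n (n + 2 * e)

theorem qGen_eq_X {S : Set (ℤ × ℤ)} {n : ℕ} {e : ℤ} (h : ((n : ℤ), (n : ℤ) + 2 * e) ∈ S) :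
    qGen S n e = X (some ⟨_, h⟩) := dif_pos h

theorem qGen_three (S : Set (ℤ × ℤ)) : qGen S 3 (-1) = q S 3 1 := by
  rw [qGen]; norm_num

theorem mem_qIndexHat (n : ℕ) {e : ℤ} (he : -1 ≤ e) : ((n : ℤ), (n : ℤ) + 2 * e) ∈ qIndexHat := by
  simp only [qIndexHat, qIndex, Set.mem_union, Set.mem_ofPred_eq, Set.mem_insert_iff, Prod.mk.injEq,
    Set.mem_singleton_iff, Int.ModEq]
  omega

theorem mem_qIndex (n : ℕ) {e : ℤ} (he : 1 ≤ n + 2 * e) :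
    ((n : ℤ), (n : ℤ) + 2 * e) ∈ qIndex := by
  simp only [qIndex, Set.mem_ofPred_eq, Int.ModEq]
  omega

theorem surfaceMinusHat_qGen (n : ℕ) {e : ℤ} (he : -1 ≤ e) :
    surfaceMinusHat (qGen qIndexHat n e) = C (choose2 n) *
      (qGen qIndexHat (n - 2) (e + 1) + X none * qGen qIndexHat (n - 2) e) := by
  rw [qGen_eq_X (mem_qIndexHat n he), surfaceMinusHat_X_some]
  dsimp only
  rcases n with _ | _ | n
  · simp [choose2]
  · simp [choose2]
  · have e1 : q qIndexHat (((n + 1 + 1 : ℕ) : ℤ) - 2) (((n + 1 + 1 : ℕ) : ℤ) + 2 * e) =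
        qGen qIndexHat (n + 1 + 1 - 2) (e + 1) := by
      rw [qGen]; congr 1 <;> push_cast <;> ring
    have e2 : q qIndexHat (((n + 1 + 1 : ℕ) : ℤ) - 2) (((n + 1 + 1 : ℕ) : ℤ) + 2 * e - 2) =
        qGen qIndexHat (n + 1 + 1 - 2) e := by
      rw [qGen]; congr 1 <;> push_cast <;> ring
    rw [e1, e2]

theorem surfaceMinusHat_qGen_mul_qGen (n n' : ℕ) {e e' : ℤ} (he : -1 ≤ e) (he' : -1 ≤ e') :
    surfaceMinusHat (qGen qIndexHat n e * qGen qIndexHat n' e') =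
      qGen qIndexHat n e * surfaceMinusHat (qGen qIndexHat n' e') +
      qGen qIndexHat n' e' * surfaceMinusHat (qGen qIndexHat n e) +
      C (n * n' : ℚ) * (X none * qGen qIndexHat (n - 1) e * qGen qIndexHat (n' - 1) e' -
        qGen qIndexHat (n + n' - 2) (e + e' + 1)) := by
  rw [qGen_eq_X (mem_qIndexHat n he), qGen_eq_X (mem_qIndexHat n' he'), surfaceMinusHat_X_mul_X]
  dsimp only
  congr 1
  rcases n with _ | n
  · simp
  rcases n' with _ | n'
  · simp
  have e1 : ∀ (n : ℕ) (e : ℤ), q qIndexHat (((n + 1 : ℕ) : ℤ) - 1) (((n + 1 : ℕ) : ℤ) + 2 * e - 1) =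
      qGen qIndexHat (n + 1 - 1) e := by
    intro n e
    rw [qGen]; congr 1 <;> push_cast <;> ring
  have e2 : q qIndexHat (((n + 1 : ℕ) : ℤ) + ((n' + 1 : ℕ) : ℤ) - 2)
      (((n + 1 : ℕ) : ℤ) + 2 * e + (((n' + 1 : ℕ) : ℤ) + 2 * e')) =
      qGen qIndexHat (n + 1 + (n' + 1) - 2) (e + e' + 1) := by
    rw [qGen, show n + 1 + (n' + 1) - 2 = n + n' by omega]; congr 1 <;> push_cast <;> ring
  rw [e1, e1, e2]
  simp

theorem gluingMinus_qGen (n : ℕ) {e : ℤ} (he : 1 ≤ n + 2 * e) :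
    gluingMinus (qGen qIndex n e) = C (choose2 n) * qGen qIndex (n - 2) (e + 1) := by
  rw [qGen_eq_X (mem_qIndex n he), gluingMinus_X_some]
  dsimp only
  rcases n with _ | _ | n
  · simp [choose2]
  · simp [choose2]
  · rw [qGen]; congr 2 <;> push_cast <;> ring

theorem gluingMinus_qGen_mul_qGen (n n' : ℕ) {e e' : ℤ} (he : 1 ≤ n + 2 * e)
    (he' : 1 ≤ n' + 2 * e') :
    gluingMinus (qGen qIndex n e * qGen qIndex n' e') =
      qGen qIndex n e * gluingMinus (qGen qIndex n' e') +
      qGen qIndex n' e' * gluingMinus (qGen qIndex n e) -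
      C (n * n' : ℚ) * qGen qIndex (n + n' - 2) (e + e' + 1) := by
  rw [qGen_eq_X (mem_qIndex n he), qGen_eq_X (mem_qIndex n' he'), gluingMinus_X_mul_X]
  dsimp only
  congr 1
  rcases n with _ | n
  · simp
  rcases n' with _ | n'
  · simp
  rw [qGen, show n + 1 + (n' + 1) - 2 = n + n' by omega]
  congr 2 <;> push_cast <;> ring

/-- The value at `q_{0,2e}` of the pullback map followed by the evaluation `ξ_{-1} ↦ 0`,
`ξ_0 ↦ 6 k - 4`. -/
noncomputable def xiScalar (k : ℕ) (e : ℤ) : LambdaXiInv :=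
  LaurentPolynomial.C (if e = -1 then 0 else if e = 0 then C (6 * (k : ℚ) - 4) else X e.toNat) +
    LaurentPolynomial.T e

/-- The Laurent variable `φ` as a unit. -/
noncomputable def phiUnit : LambdaXiInvˣ where
  val := LaurentPolynomial.T 1
  inv := LaurentPolynomial.T (-1)
  val_inv := by rw [← LaurentPolynomial.T_add]; simp
  inv_val := by rw [← LaurentPolynomial.T_add]; simp

theorem xiScalar_neg_one (k : ℕ) : xiScalar k (-1) = ((phiUnit⁻¹ : LambdaXiInvˣ) : LambdaXiInv) := by
  simp [xiScalar, phiUnit]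

theorem xiScalar_zero (k : ℕ) : xiScalar k 0 = 2 * ((3 * k : ℕ) : LambdaXiInv) - 3 := by
  have : (C (6 * (k : ℚ) - 4) : MvPolynomial ℕ ℚ) = 6 * (k : MvPolynomial ℕ ℚ) - 4 := by
    simp only [map_sub, map_mul, map_natCast, map_ofNat]
  rw [xiScalar, if_neg (by decide), if_pos rfl, this, LaurentPolynomial.T_zero]
  simp only [map_sub, map_mul, map_natCast, map_ofNat]
  push_cast
  ring

/-- The map from the extended ring to the model ring. -/
noncomputable def capHom (k : ℕ) : LambdaQHat →ₐ[ℚ] ModelRing LambdaXiInv :=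
  aeval fun v => match v with
    | none => C (LaurentPolynomial.T 1)
    | some ⟨(i, j), _⟩ => modelS (xiScalar k) i.toNat ((j - i) / 2)

/-- The map from `Λ_q` to the model ring. The summand `-φ ^ e z ^ n` of the image of `q_{n,n+2e}`
is the contribution of the additional coordinate. -/
noncomputable def fullHom (k : ℕ) : LambdaQ →ₐ[ℚ] ModelRing LambdaXiInv :=
  aeval fun v => match v with
    | none => C (LaurentPolynomial.T 1)
    | some ⟨(i, j), _⟩ => modelS (xiScalar k) i.toNat ((j - i) / 2) -
        C (LaurentPolynomial.T ((j - i) / 2)) * modelZ ^ i.toNat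

theorem capHom_X_none (k : ℕ) : capHom k (X none) = C (LaurentPolynomial.T 1) := by
  rw [capHom, aeval_X]

theorem capHom_qGen (k n : ℕ) {e : ℤ} (he : -1 ≤ e) :
    capHom k (qGen qIndexHat n e) = modelS (xiScalar k) n e := by
  rw [qGen_eq_X (mem_qIndexHat n he), capHom, aeval_X]
  dsimp only
  rw [Int.toNat_natCast, add_sub_cancel_left, Int.mul_ediv_cancel_left _ (by norm_num)]

theorem fullHom_qGen (k n : ℕ) {e : ℤ} (he : 1 ≤ n + 2 * e) :
    fullHom k (qGen qIndex n e) =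
      modelS (xiScalar k) n e - C (LaurentPolynomial.T e) * modelZ ^ n := by
  rw [qGen_eq_X (mem_qIndex n he), fullHom, aeval_X]
  dsimp only
  rw [Int.toNat_natCast, add_sub_cancel_left, Int.mul_ediv_cancel_left _ (by norm_num)]

/-- Evaluation of the model ring at the origin is the specialised pullback map. -/
theorem aeval_zero_capHom (k : ℕ) (x : LambdaQHat) :
    (aeval 0 : ModelRing LambdaXiInv →ₐ[LambdaXiInv] LambdaXiInv) (capHom k x) =
      evalXi (6 * (k : ℚ) - 4) (pullbackHat x) := by
  have hT : ∀ n : ℤ, evalXi (6 * (k : ℚ) - 4) (LaurentPolynomial.T n) =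
      LaurentPolynomial.T n := by
    intro n
    rw [evalXi, LaurentPolynomial.T, AddMonoidAlgebra.mapAlgHom_single, map_one]
    rfl
  have hC : ∀ (c : ℚ) (p : MvPolynomial {n : ℤ // -1 ≤ n} ℚ),
      evalXi c (LaurentPolynomial.C p) = LaurentPolynomial.C (aeval (fun n : {n : ℤ // -1 ≤ n} =>
        if n.1 = -1 then (0 : MvPolynomial ℕ ℚ) else if n.1 = 0 then C c else X n.1.toNat) p) := by
    intro c p
    exact AddMonoidAlgebra.mapAlgHom_single _ _ _
  have key : ((aeval 0 : ModelRing LambdaXiInv →ₐ[LambdaXiInv] LambdaXiInv).restrictScalars ℚ).comp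
      (capHom k) = (evalXi (6 * (k : ℚ) - 4)).comp pullbackHat := by
    refine algHom_ext fun v => ?_
    rw [AlgHom.comp_apply, AlgHom.comp_apply, AlgHom.restrictScalars_apply, capHom, pullbackHat,
      aeval_X, aeval_X]
    rcases v with _ | ⟨⟨i, j⟩, hij⟩
    · rw [hT]
      simp
    · dsimp only
      have hi : 0 ≤ i := by
        rcases hij with h | h | h
        · exact h.1
        · simp only [Prod.mk.injEq] at h; omega
        · simp only [Set.mem_singleton_iff, Prod.mk.injEq] at h; omega
      obtain ⟨n, rfl⟩ := Int.eq_ofNat_of_zero_le hi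
      rcases n with _ | n
      · rw [dif_pos (by simp), map_add, hT, hC, aeval_X]
        simp [modelS, xiScalar]
      · rw [dif_neg (by omega), map_zero]
        simp [modelS]
  exact congrArg (fun f => f x) key

/-- Evaluation of the model ring at the origin is the identification `q_{0,2n} = ξ_n`, as long as
`q_{0,0}`, which the model sends to the scalar `6 k - 4`, does not occur. -/
theorem aeval_zero_fullHom (k : ℕ) {x : LambdaQ}
    (hx : x ∈ Algebra.adjoin ℚ {x | ∃ (n : ℕ) (e : ℤ), 1 ≤ n + 2 * e ∧ x = qGen qIndex n e}) :
    (aeval 0 : ModelRing LambdaXiInv →ₐ[LambdaXiInv] LambdaXiInv) (fullHom k x) = qToXi x := by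
  -- For `n = 0` the summand `-φ ^ e` cancels the shift `φ ^ e` of the pullback map.
  induction hx using Algebra.adjoin_induction with
  | mem x hx =>
    obtain ⟨n, e, he, rfl⟩ := hx
    rw [fullHom_qGen k n he, qGen_eq_X (mem_qIndex n he), qToXi, aeval_X]
    dsimp only
    rcases n with _ | n
    · have h1 : e ≠ -1 := by omega
      have h2 : e ≠ 0 := by omega
      simp [modelS, xiScalar, h1, h2]
    · rw [if_neg (by omega)]
      simp [modelS, modelZ]
  | algebraMap r =>
    rw [AlgHom.commutes, AlgHom.commutes, IsScalarTower.algebraMap_apply ℚ LambdaXiInv,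
      AlgHom.commutes]
    rfl
  | add x y _ _ hx hy => rw [map_add, map_add, map_add, hx, hy]
  | mul x y _ _ hx hy => rw [map_mul, map_mul, map_mul, hx, hy]

theorem qToXi_mem_range {x : LambdaQ}
    (hx : x ∈ Algebra.adjoin ℚ {x | ∃ (n : ℕ) (e : ℤ), 1 ≤ n + 2 * e ∧ x = qGen qIndex n e}) :
    ∃ P : MvPolynomial ℕ ℚ, qToXi x = LaurentPolynomial.C P := by
  induction hx using Algebra.adjoin_induction with
  | mem x hx =>
    obtain ⟨n, e, he, rfl⟩ := hx
    rw [qGen_eq_X (mem_qIndex n he), qToXi, aeval_X]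
    dsimp only
    split_ifs
    · exact ⟨_, rfl⟩
    · exact ⟨0, (map_zero _).symm⟩
  | algebraMap r => exact ⟨C r, by rw [AlgHom.commutes]; rfl⟩
  | add x y _ _ hx hy =>
    obtain ⟨P, hP⟩ := hx
    obtain ⟨Q, hQ⟩ := hy
    exact ⟨P + Q, by rw [map_add, map_add, hP, hQ]⟩
  | mul x y _ _ hx hy =>
    obtain ⟨P, hP⟩ := hx
    obtain ⟨Q, hQ⟩ := hy
    exact ⟨P * Q, by rw [map_mul, map_mul, hP, hQ]⟩

theorem restrictScalars_pow_apply {K B : Type*} [CommRing K] [CommRing B] [Algebra K B]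
    [Algebra ℚ K] [Algebra ℚ B] [IsScalarTower ℚ K B] (Δ : Module.End K B) (n : ℕ) (x : B) :
    ((Δ.restrictScalars ℚ : Module.End ℚ B) ^ n) x = (Δ ^ n) x := by
  induction n with
  | zero => rfl
  | succ n ih => rw [pow_succ', pow_succ', Module.End.mul_apply, ih]; rfl

theorem algebraMap_choose2 {K : Type*} [CommRing K] [Algebra ℚ K] (n : ℕ) :
    algebraMap ℚ (ModelRing K) (choose2 n) =
      C (half K) * ((n : ModelRing K) * ((n : ModelRing K) - 1)) := by
  have : choose2 (n : ℤ) = 1 / 2 * ((n : ℚ) * ((n : ℚ) - 1)) := by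
    rw [choose2, Int.cast_natCast]; ring
  rw [this, map_mul, map_mul, map_sub, map_natCast, map_one,
    IsScalarTower.algebraMap_apply ℚ K (ModelRing K)]
  rfl

theorem modelGlue_modelZ_pow {K : Type*} [CommRing K] [Algebra ℚ K] (c : ℤ → K) (n : ℕ) :
    modelGlue c (modelZ ^ n) = 0 := by
  induction n with
  | zero => rw [pow_zero, (isSecondOrder_modelGlue c).map_one]
  | succ n ih =>
    rw [pow_succ', (isSecondOrder_modelGlue c).map_mul, ih, modelGlue_modelZ,
      modelGlue_bracket_modelZ]
    simp

theorem algHom_C {σ A : Type*} [CommRing A] [Algebra ℚ A] (f : MvPolynomial σ ℚ →ₐ[ℚ] A)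
    (r : ℚ) : f (C r) = algebraMap ℚ A r := f.commutes r

/-- On the subalgebra generated by `φ` and by the `q_{i,j}` with `i - j ≤ 2`, no index leaves the
range of the extended ring, and the capped surface operator becomes the capped model operator. -/
theorem capHom_surfaceMinusHat_pow (k n : ℕ) :
    capHom k ((surfaceMinusHat ^ n) (q qIndexHat 3 1 ^ (2 * k))) =
      (modelCap (xiScalar k) phiUnit ^ n) (modelS (xiScalar k) 3 (-1) ^ (2 * k)) := by
  set s : Set LambdaQHat := {x | x = X none ∨ ∃ (n : ℕ) (e : ℤ), -1 ≤ e ∧ x = qGen qIndexHat n e}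
    with hs
  have hphi : (phiUnit : LambdaXiInv) = LaurentPolynomial.T 1 := rfl
  have hΔ := isSecondOrder_modelCap (xiScalar k) phiUnit
  have hnone : X none ∈ Algebra.adjoin ℚ s := Algebra.subset_adjoin (Or.inl rfl)
  have hgen : ∀ (n : ℕ) (e : ℤ), -1 ≤ e → qGen qIndexHat n e ∈ Algebra.adjoin ℚ s :=
    fun n e he => Algebra.subset_adjoin (Or.inr ⟨n, e, he, rfl⟩)
  have hC : ∀ r : ℚ, (C r : LambdaQHat) ∈ Algebra.adjoin ℚ s :=
    fun r => Subalgebra.algebraMap_mem _ r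
  have hmem : ∀ (n : ℕ) (e : ℤ), -1 ≤ e →
      surfaceMinusHat (qGen qIndexHat n e) ∈ Algebra.adjoin ℚ s := by
    intro n e he
    rw [surfaceMinusHat_qGen n he]
    exact mul_mem (hC _) (add_mem (hgen _ _ (by omega)) (mul_mem hnone (hgen _ _ he)))
  have hval : ∀ (n : ℕ) (e : ℤ), -1 ≤ e → capHom k (surfaceMinusHat (qGen qIndexHat n e)) =
      modelCap (xiScalar k) phiUnit (capHom k (qGen qIndexHat n e)) := by
    intro n e he
    rw [surfaceMinusHat_qGen n he, map_mul, map_add, map_mul, algHom_C, capHom_X_none,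
      capHom_qGen k _ he, capHom_qGen k _ he, capHom_qGen k _ (by omega), algebraMap_choose2,
      modelCap_modelS, hphi]
  have hnone_mul : ∀ x : LambdaQHat, surfaceMinusHat (X none * x) = X none * surfaceMinusHat x := by
    intro x
    have hb : isSecondOrder_surfaceMinusHat.bracket (X none) = 0 := derivation_ext fun v => by
      rw [IsSecondOrder.bracket_apply, surfaceMinusHat_X_none_mul_X, surfaceMinusHat_X_none]
      simp
    rw [isSecondOrder_surfaceMinusHat.map_mul, hb, surfaceMinusHat_X_none]
    simp
  have h := isSecondOrder_surfaceMinusHat.intertwine_pow (hΔ.restrictScalars (R' := ℚ))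
    (capHom k) s ?_ ?_ ?_ ?_ n (pow_mem (hgen 3 (-1) le_rfl) (2 * k))
  · rw [restrictScalars_pow_apply, map_pow (capHom k), capHom_qGen k _ le_rfl, qGen_three] at h
    exact h.2
  · rintro x (rfl | ⟨n, e, he, rfl⟩)
    · rw [surfaceMinusHat_X_none]; exact zero_mem _
    · exact hmem n e he
  · rintro x (rfl | ⟨n, e, he, rfl⟩) y hy
    · rw [hnone_mul]
      rcases hy with rfl | ⟨n', e', he', rfl⟩
      · rw [surfaceMinusHat_X_none, mul_zero]; exact zero_mem _
      · exact mul_mem hnone (hmem n' e' he')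
    · rcases hy with rfl | ⟨n', e', he', rfl⟩
      · rw [mul_comm, hnone_mul]
        exact mul_mem hnone (hmem n e he)
      · rw [surfaceMinusHat_qGen_mul_qGen n n' he he']
        exact add_mem (add_mem (mul_mem (hgen _ _ he) (hmem _ _ he'))
          (mul_mem (hgen _ _ he') (hmem _ _ he))) (mul_mem (hC _)
          (sub_mem (mul_mem (mul_mem hnone (hgen _ _ he)) (hgen _ _ he')) (hgen _ _ (by omega))))
  · rintro x (rfl | ⟨n, e, he, rfl⟩)
    · rw [surfaceMinusHat_X_none, capHom_X_none, map_zero]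
      exact (hΔ.map_C _).symm
    · exact hval n e he
  · rintro x (rfl | ⟨n, e, he, rfl⟩) y hy
    · rw [hnone_mul, map_mul, map_mul, capHom_X_none]
      refine Eq.trans ?_ (modelRing_map_C_mul (Δ := modelCap (xiScalar k) phiUnit) _ _).symm
      rcases hy with rfl | ⟨n', e', he', rfl⟩
      · rw [surfaceMinusHat_X_none, capHom_X_none, hΔ.map_C, map_zero]
      · rw [hval _ _ he']
    · rcases hy with rfl | ⟨n', e', he', rfl⟩
      · rw [mul_comm, hnone_mul, map_mul, map_mul, capHom_X_none]
        refine Eq.trans ?_ (modelRing_map_C_mul (Δ := modelCap (xiScalar k) phiUnit) _ _).symm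
        rw [hval _ _ he]
      · rw [surfaceMinusHat_qGen_mul_qGen n n' he he', map_mul (capHom k) (qGen qIndexHat n e)]
        refine Eq.trans ?_ (hΔ.map_mul _ _).symm
        simp only [map_add, map_mul, map_sub, hval _ _ he, hval _ _ he', capHom_qGen k _ he,
          capHom_qGen k _ he', capHom_qGen k _ (show -1 ≤ e + e' + 1 by omega), capHom_X_none,
          modelCap_bracket_modelS, hphi, map_natCast]

/-- The gluing operator of `Λ_q` becomes the Laplacian with the additional coordinate `z`. The
result stays in the subalgebra generated by the `q_{i,j}` with `j ≥ 1`, which does not contain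
`q_{0,0}`. -/
theorem fullHom_gluingMinus_pow (k n : ℕ) :
    (gluingMinus ^ n) (q qIndex 3 1 ^ (2 * k)) ∈ Algebra.adjoin ℚ
        {x | ∃ (n : ℕ) (e : ℤ), 1 ≤ n + 2 * e ∧ x = qGen qIndex n e} ∧
      fullHom k ((gluingMinus ^ n) (q qIndex 3 1 ^ (2 * k))) =
        ((modelSplitting (xiScalar_neg_one k) (xiScalar_zero k)).full ^ n)
          ((modelS (xiScalar k) 3 (-1) -
            C ((phiUnit⁻¹ : LambdaXiInvˣ) : LambdaXiInv) * modelZ ^ 3) ^ (2 * k)) := by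
  set s : Set LambdaQ := {x | ∃ (n : ℕ) (e : ℤ), 1 ≤ n + 2 * e ∧ x = qGen qIndex n e} with hs
  set Δ := (modelSplitting (xiScalar_neg_one k) (xiScalar_zero k)).full with hΔdef
  have hΔapply : ∀ x, Δ x = modelGlue (xiScalar k) x +
      C (half LambdaXiInv) * C (LaurentPolynomial.T 1) * modelDz (modelDz x) :=
    modelSplitting_full_apply (xiScalar_neg_one k) (xiScalar_zero k)
  have hG := isSecondOrder_modelGlue (xiScalar k)
  have hΔ : IsSecondOrder Δ := by
    have : Δ = modelGlue (xiScalar k) + (half LambdaXiInv * LaurentPolynomial.T 1) •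
        (modelDz.toLinearMap * modelDz.toLinearMap) := by
      refine LinearMap.ext fun x => ?_
      rw [hΔapply, ← C_mul, ← smul_eq_C_mul]
      rfl
    rw [this]
    exact hG.add ((IsSecondOrder.derivation_mul _ _).smul _)
  have hbracket : ∀ x y, hΔ.bracket x y =
      hG.bracket x y + C (LaurentPolynomial.T 1) * modelDz x * modelDz y := by
    intro x y
    rw [IsSecondOrder.bracket_apply, IsSecondOrder.bracket_apply, hΔapply, hΔapply, hΔapply]
    simp only [Derivation.leibniz, map_add, smul_eq_mul]
    linear_combination C (LaurentPolynomial.T 1) * modelDz x * modelDz y *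
      C_half_mul_two (K := LambdaXiInv)
  have hgen : ∀ (n : ℕ) (e : ℤ), 1 ≤ n + 2 * e → qGen qIndex n e ∈ Algebra.adjoin ℚ s :=
    fun n e he => Algebra.subset_adjoin ⟨n, e, he, rfl⟩
  have hC : ∀ r : ℚ, (C r : LambdaQ) ∈ Algebra.adjoin ℚ s :=
    fun r => Subalgebra.algebraMap_mem _ r
  have hmem : ∀ (n : ℕ) (e : ℤ), 1 ≤ n + 2 * e →
      gluingMinus (qGen qIndex n e) ∈ Algebra.adjoin ℚ s := by
    intro n e he
    rw [gluingMinus_qGen n he]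
    exact mul_mem (hC _) (hgen _ _ (by omega))
  have hDz : ∀ (n : ℕ) (e : ℤ), modelDz (modelS (xiScalar k) n e -
      C (LaurentPolynomial.T e) * modelZ ^ n) =
      -((n : ModelRing LambdaXiInv) * C (LaurentPolynomial.T e) * modelZ ^ (n - 1)) := by
    intro n e
    rw [map_sub, modelDz_modelS, Derivation.leibniz, derivation_C, Derivation.leibniz_pow,
      modelDz_modelZ]
    simp only [smul_eq_mul, nsmul_eq_mul]
    ring
  have hT : ∀ a b : ℤ, (C (LaurentPolynomial.T (a + b)) : ModelRing LambdaXiInv) =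
      C (LaurentPolynomial.T a) * C (LaurentPolynomial.T b) := by
    intro a b
    rw [LaurentPolynomial.T_add, C_mul]
  have hval : ∀ (n : ℕ) (e : ℤ), 1 ≤ n + 2 * e → fullHom k (gluingMinus (qGen qIndex n e)) =
      Δ (fullHom k (qGen qIndex n e)) := by
    intro n e he
    rw [gluingMinus_qGen n he, map_mul, algHom_C, fullHom_qGen k _ he,
      fullHom_qGen k _ (by omega), algebraMap_choose2, hΔapply, hDz]
    rw [map_sub, modelRing_map_C_mul, modelGlue_modelZ_pow, modelGlue_modelS, map_neg,
      Derivation.leibniz, Derivation.leibniz, derivation_C, Derivation.map_natCast,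
      Derivation.leibniz_pow, modelDz_modelZ, hT e 1]
    rcases n with _ | _ | n
    · simp
    · simp
    · simp only [smul_eq_mul, nsmul_eq_mul, show n + 1 + 1 - 1 = n + 1 by omega, show n + 1 + 1 - 2 = n by omega]
      push_cast
      ring
  have h := isSecondOrder_gluingMinus.intertwine_pow (hΔ.restrictScalars (R' := ℚ))
    (fullHom k) s ?_ ?_ ?_ ?_ n (pow_mem (hgen 3 (-1) (by norm_num)) (2 * k))
  · rw [restrictScalars_pow_apply, map_pow (fullHom k), fullHom_qGen k _ (by norm_num),
      qGen_three] at h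
    exact h
  · rintro x ⟨n, e, he, rfl⟩
    exact hmem n e he
  · rintro x ⟨n, e, he, rfl⟩ y ⟨n', e', he', rfl⟩
    rw [gluingMinus_qGen_mul_qGen n n' he he']
    exact sub_mem (add_mem (mul_mem (hgen _ _ he) (hmem _ _ he'))
      (mul_mem (hgen _ _ he') (hmem _ _ he))) (mul_mem (hC _) (hgen _ _ (by omega)))
  · rintro x ⟨n, e, he, rfl⟩
    exact hval n e he
  · rintro x ⟨n, e, he, rfl⟩ y ⟨n', e', he', rfl⟩
    rw [gluingMinus_qGen_mul_qGen n n' he he', map_mul (fullHom k) (qGen qIndex n e)]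
    refine Eq.trans ?_ (hΔ.map_mul _ _).symm
    have hz : ∀ (a : LambdaXiInv) (n : ℕ) (x : ModelRing LambdaXiInv),
        hG.bracket (C a * modelZ ^ n) x = 0 := by
      intro a n x
      rw [hG.bracket_comm, Derivation.leibniz, derivation_C, Derivation.leibniz_pow,
        hG.bracket_comm, modelGlue_bracket_modelZ]
      simp
    rw [hbracket, fullHom_qGen k _ he, fullHom_qGen k _ he', hDz, hDz, map_sub (hG.bracket _),
      hG.bracket_comm _ (C _ * modelZ ^ n'), hz, hG.bracket_comm _ (modelS _ _ _),
      map_sub (hG.bracket _), hG.bracket_comm _ (C _ * modelZ ^ n), hz, modelGlue_bracket_modelS,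
      ← fullHom_qGen k _ he, ← fullHom_qGen k _ he']
    simp only [map_add, map_sub, map_mul (fullHom k), hval _ _ he, hval _ _ he',
      fullHom_qGen k (n + n' - 2) (show 1 ≤ ((n + n' - 2 : ℕ) : ℤ) + 2 * (e + e' + 1) by omega),
      map_mul C, map_natCast, hT]
    rw [add_comm n' n, add_comm e' e]
    rcases n with _ | n
    · simp
    rcases n' with _ | n'
    · simp
    simp only [Nat.add_sub_cancel, show n + 1 + (n' + 1) - 2 = n + n' by omega]
    push_cast
    ring

end Evaluation

end SurfaceGluing

theorem mainTheorem4 (k : ℕ) (hk : 1 ≤ k) :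
    (∃ P : MvPolynomial ℕ ℚ,
      SurfaceGluing.evalXi (6 * (k : ℚ) - 4)
        (SurfaceGluing.pullbackHat
          ((SurfaceGluing.surfaceMinusHat ^ (3 * k))
            (SurfaceGluing.q SurfaceGluing.qIndexHat 3 1 ^ (2 * k)))) =
      LaurentPolynomial.C P) ∧
    SurfaceGluing.evalXi (6 * (k : ℚ) - 4)
        (SurfaceGluing.pullbackHat
          ((SurfaceGluing.surfaceMinusHat ^ (3 * k))
            (SurfaceGluing.q SurfaceGluing.qIndexHat 3 1 ^ (2 * k)))) =
      SurfaceGluing.qToXi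
        ((SurfaceGluing.gluingMinus ^ (3 * k))
          (SurfaceGluing.q SurfaceGluing.qIndex 3 1 ^ (2 * k))) := by
  obtain ⟨hmem, hfull⟩ := SurfaceGluing.fullHom_gluingMinus_pow k (3 * k)
  have key : SurfaceGluing.evalXi (6 * (k : ℚ) - 4)
        (SurfaceGluing.pullbackHat
          ((SurfaceGluing.surfaceMinusHat ^ (3 * k))
            (SurfaceGluing.q SurfaceGluing.qIndexHat 3 1 ^ (2 * k)))) =
      SurfaceGluing.qToXi
        ((SurfaceGluing.gluingMinus ^ (3 * k))
          (SurfaceGluing.q SurfaceGluing.qIndex 3 1 ^ (2 * k))) := by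
    rw [← SurfaceGluing.aeval_zero_capHom, SurfaceGluing.capHom_surfaceMinusHat_pow,
      ← SurfaceGluing.aeval_zero_fullHom k hmem, hfull]
    exact (SurfaceGluing.modelSplitting_contract (by ring) _ _).symm
  refine ⟨?_, key⟩
  rw [key]
  exact SurfaceGluing.qToXi_mem_range hmem
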